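/- Let $L\ge 1$ and let $R,V,T\in\mathbb C^{L\times L}$ with $R$ and $T$ invertible. For $N\ge 1$ let $H_N\in\mathbb C^{NL\times NL}$ be the block tridiagonal matrix with all diagonal blocks equal to $V$, all blocks directly above the diagonal equal to $T$, all blocks directly below the diagonal equal to $R$, and all other blocks $0$. For $E\in\mathbb C$ let $$\mathcal T^E=\begin{pmatrix}(E\mathbf 1-V)T^{-1}&-R\\ T^{-1}&0\end{pmatrix}\in\mathbb C^{2L\times 2L}$$ be the transfer matrix, and let $z_1(E),\dots,z_{2L}(E)$ be its eigenvalues, listed with algebraic multiplicity and ordered so that $|z_l(E)|\le|z_{l+1}(E)|$. Put $\Lambda=\{E\in\mathbb C:|z_L(E)|=|z_{L+1}(E)|\}$. For $E\in\mathbb C\setminus\Lambda$ let $I_0=\{1,\dots,L\}$, let $$\mathcal R^E_{I_0}=\oint_{|z|=s}\frac{dz}{2\pi\imath}\,(z\mathbf 1-\mathcal T^E)^{-1},\qquad |z_L(E)|<s<|z_{L+1}(E)|,$$ be the Riesz projection of $\mathcal T^E$ onto the eigenvalues $z_1(E),\dots,z_L(E)$, and let $q_{I_0}(E)$ be the determinant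 of the lower left $L\times L$ block of $\mathcal R^E_{I_0}$. Let $E\in\mathbb C\setminus\Lambda$, and suppose that $q_{I_0}$ is not identically zero on the connected component of $\mathbb C\setminus\Lambda$ that contains $E$. Then $q_{I_0}$ is holomorphic near $E$, and for all sufficiently small $\rho>0$ there exists $N_0\in\mathbb N$ such that for all $N>N_0$ the number of eigenvalues of $H_N$ in the open ball $B_\rho(E)$, counted with algebraic multiplicity, equals the order of $E$ as a zero of $q_{I_0}$ (the order being $0$ if $q_{I_0}(E)\neq 0$). -/

import Mathlib

namespace BlockToeplitz

noncomputable section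

/-- The finite-volume Hamiltonian `H_N`: the `N × N` block tridiagonal matrix with `L × L` blocks,
`V` on the diagonal, `T` on the upper and `R` on the lower off-diagonal. -/
def finiteHam {L : ℕ} (R V T : Matrix (Fin L) (Fin L) ℂ) (N : ℕ) :
    Matrix (Fin N × Fin L) (Fin N × Fin L) ℂ :=
  Matrix.of fun x y =>
    if y.1 = x.1 then V x.2 y.2
    else if (y.1 : ℕ) = x.1 + 1 then T x.2 y.2
    else if (x.1 : ℕ) = y.1 + 1 then R x.2 y.2
    else 0

/-- The `2L × 2L` transfer matrix at energy `E`. -/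
def transferMatrix {L : ℕ} (R V T : Matrix (Fin L) (Fin L) ℂ) (E : ℂ) :
    Matrix (Fin L ⊕ Fin L) (Fin L ⊕ Fin L) ℂ :=
  Matrix.fromBlocks ((E • (1 : Matrix (Fin L) (Fin L) ℂ) - V) * T⁻¹) (-R) T⁻¹ 0

open Classical in
/-- The eigenvalues of `A`, repeated according to algebraic multiplicity, listed by nondecreasing
modulus (the order among eigenvalues of the same modulus is an arbitrary choice). -/
def orderedEigenvalues {n : Type*} [Fintype n] [DecidableEq n] (A : Matrix n n ℂ) : List ℂ :=
  A.charpoly.roots.toList.insertionSort (fun z w => ‖z‖ ≤ ‖w‖)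

theorem coe_orderedEigenvalues {n : Type*} [Fintype n] [DecidableEq n] (A : Matrix n n ℂ) :
    (orderedEigenvalues A : Multiset ℂ) = A.charpoly.roots := by
  classical
  conv_rhs => rw [← Multiset.coe_toList A.charpoly.roots]
  exact Multiset.coe_eq_coe.2 (List.perm_insertionSort _ _)

theorem length_orderedEigenvalues {n : Type*} [Fintype n] [DecidableEq n] (A : Matrix n n ℂ) :
    (orderedEigenvalues A).length = Fintype.card n := by
  rw [← Multiset.coe_card, coe_orderedEigenvalues, ← A.charpoly_natDegree_eq_dim]
  exact (IsAlgClosed.splits A.charpoly).natDegree_eq_card_roots.symm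

theorem pairwise_orderedEigenvalues {n : Type*} [Fintype n] [DecidableEq n] (A : Matrix n n ℂ) :
    (orderedEigenvalues A).Pairwise (fun z w => ‖z‖ ≤ ‖w‖) := by
  classical
  have : Std.Total (fun z w : ℂ => ‖z‖ ≤ ‖w‖) := ⟨fun a b => le_total ‖a‖ ‖b‖⟩
  have : IsTrans ℂ (fun z w : ℂ => ‖z‖ ≤ ‖w‖) := ⟨fun _ _ _ h₁ h₂ => le_trans h₁ h₂⟩
  exact List.pairwise_insertionSort (fun z w : ℂ => ‖z‖ ≤ ‖w‖) _

/-- The eigenvalue `z_l(E)` of the transfer matrix, `1 ≤ l ≤ 2L`. -/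
def eigZ {L : ℕ} (R V T : Matrix (Fin L) (Fin L) ℂ) (E : ℂ) (l : ℕ) : ℂ :=
  (orderedEigenvalues (transferMatrix R V T E)).getD (l - 1) 0

/-- The set `Λ` of energies at which the middle two eigenvalues have the same modulus. -/
def setLambda {L : ℕ} (R V T : Matrix (Fin L) (Fin L) ℂ) : Set ℂ :=
  {E | ‖eigZ R V T E L‖ = ‖eigZ R V T E (L + 1)‖}

/-- The (entrywise) contour integral `(2πi)⁻¹ ∮ (z 1 - A)⁻¹ dz` over the circle `|z| = s`: the Riesz
projection of `A` onto its eigenvalues of modulus less than `s`. -/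
def rieszProj {n : Type*} [Fintype n] [DecidableEq n] (A : Matrix n n ℂ) (s : ℝ) : Matrix n n ℂ :=
  Matrix.of fun i j =>
    (2 * (Real.pi : ℂ) * Complex.I)⁻¹ * ∮ z in C(0, s), ((z • (1 : Matrix n n ℂ) - A)⁻¹) i j

/-- The Riesz projection of the transfer matrix onto the eigenvalues `z_1(E), …, z_L(E)`. For
`E ∉ Λ` the chosen circle winds once around `0, z_1(E), …, z_L(E)` and not around the others.
(On `Λ` the value has no meaning.) -/
def rieszI0 {L : ℕ} (R V T : Matrix (Fin L) (Fin L) ℂ) (E : ℂ) :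
    Matrix (Fin L ⊕ Fin L) (Fin L ⊕ Fin L) ℂ :=
  rieszProj (transferMatrix R V T E) ((‖eigZ R V T E L‖ + ‖eigZ R V T E (L + 1)‖) / 2)

/-- The function `q_{I_0}`: the determinant of the lower left `L × L` block of the Riesz
projection. -/
def qI0 {L : ℕ} (R V T : Matrix (Fin L) (Fin L) ℂ) (E : ℂ) : ℂ :=
  (rieszI0 R V T E).toBlocks₂₁.det

open Classical in
/-- The number of eigenvalues of `A` in the open ball of radius `ρ` around `E`, counted with
algebraic multiplicity. -/
def eigCount {n : Type*} [Fintype n] [DecidableEq n] (A : Matrix n n ℂ) (E : ℂ) (ρ : ℝ) : ℕ :=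
  A.charpoly.roots.countP (fun z => z ∈ Metric.ball E ρ)

end

end BlockToeplitz

/-!
Write `𝒯` for the transfer matrix at energy `E`, `P` for its Riesz projection onto the `L` smallest
eigenvalues and `Q = 1 - P`. The eigenvalue equation `H_N ψ = E ψ` is a three-term recurrence solved
by the powers of `𝒯`, and `det (E - H_N)` equals, up to a factor without zeros, the determinant of
the lower left block of `𝒯 ^ (N + 1)` (`eval_charpoly_finiteHam_mul`, `det_borderedHam_ne_zero`).

Fix radii `r₁ < s < r₂` in the gap between `|z_L|` and `|z_{L+1}|`. The gap persists near `E`,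
because the number of eigenvalues in a disc is locally constant (`exists_eventually_gap`). Put
`M = (s⁻¹ 𝒯)ⁿ`. Contour integrals over the circles of radii `r₁` and `r₂` show that `M P` and
`M⁻¹ Q` decay geometrically, uniformly near `E` (`tendsto_pow_mul_rieszMoment`,
`tendsto_pow_mul_one_sub_rieszMoment`). With `π` the projection onto the first block and `K` the
map from the second block to the first, the lower left block of `M` has determinant
`det (π + M K)`. Multiplication by the invertible matrix `P + M⁻¹ Q` removes the exponential growth:
`(P + M⁻¹ Q) (π + M K) = P π + Q K + (M⁻¹ Q) π + (M P) K`, which tends to `P π + Q K`, and the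
determinant of the limit is, up to a nonzero constant, that of the lower left block of `P`, which is
`q` (`det_limit_mul`, `tendsto_compensatedDet`).

So the characteristic polynomials of `H_N`, multiplied by holomorphic functions without zeros,
converge locally uniformly to `q`. By the identity theorem on the component of the complement of
`Λ`, `q` has a zero of finite order at `E` (`analyticOrderAt_qI0_ne_top`), and Hurwitz's theorem
(`eventually_countP_roots_eq`) identifies that order with the number of eigenvalues nearby.
-/

/-! ### Riesz integrals in a complex Banach algebra -/

namespace BlockToeplitz

open Filter Topology Metric

theorem _root_.ContinuousLinearMap.circleIntegral_comp_comm {F G : Type*}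
    [NormedAddCommGroup F] [NormedSpace ℂ F] [CompleteSpace F]
    [NormedAddCommGroup G] [NormedSpace ℂ G] [CompleteSpace G]
    (φ : F →L[ℂ] G) {f : ℂ → F} {c : ℂ} {r : ℝ} (hf : CircleIntegrable f c r) :
    (∮ z in C(c, r), φ (f z)) = φ (∮ z in C(c, r), f z) := by
  simp only [circleIntegral, ← map_smul]
  exact φ.intervalIntegral_comp_comm hf.out

section BanachAlgebra

variable {𝔸 : Type*} [NormedRing 𝔸] [NormedAlgebra ℂ 𝔸]

/-- The contour integral `(2πi)⁻¹ ∮ z ^ k (z - a)⁻¹ dz` over the circle `|z| = r`. For `k = 0` this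
is the Riesz projection of `a` onto the part of its spectrum inside the circle. -/
noncomputable def rieszMoment (a : 𝔸) (r : ℝ) (k : ℤ) : 𝔸 :=
  (2 * (Real.pi : ℂ) * Complex.I)⁻¹ • ∮ z in C(0, r), z ^ k • resolvent a z

theorem mul_resolvent {a : 𝔸} {z : ℂ} (hz : z ∈ resolventSet ℂ a) :
    a * resolvent a z = z • resolvent a z - 1 := by
  have h : (algebraMap ℂ 𝔸 z - a) * resolvent a z = 1 := Ring.mul_inverse_cancel _ hz
  rw [sub_mul, ← Algebra.smul_def] at h
  rw [← h]; abel

theorem resolvent_mul {a : 𝔸} {z : ℂ} (hz : z ∈ resolventSet ℂ a) :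
    resolvent a z * a = z • resolvent a z - 1 := by
  have h : resolvent a z * (algebraMap ℂ 𝔸 z - a) = 1 := Ring.inverse_mul_cancel _ hz
  rw [mul_sub, ← Algebra.commutes, ← Algebra.smul_def] at h
  rw [← h]; abel

theorem continuousAt_resolvent_prod [CompleteSpace 𝔸] {X : Type*} [TopologicalSpace X] {a : X → 𝔸}
    {x : X} {z : ℂ} (ha : ContinuousAt a x) (hz : z ∈ resolventSet ℂ (a x)) :
    ContinuousAt (fun p : X × ℂ => resolvent (a p.1) p.2) (x, z) := by
  have h1 : ContinuousAt (fun p : X × ℂ => algebraMap ℂ 𝔸 p.2 - a p.1) (x, z) :=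
    ((continuous_algebraMap ℂ 𝔸).comp continuous_snd).continuousAt.sub
      (ContinuousAt.comp (f := Prod.fst) (x := (x, z)) ha continuousAt_fst)
  have h2 : ContinuousAt Ring.inverse (algebraMap ℂ 𝔸 z - a x) := by
    simpa using! NormedRing.inverse_continuousAt hz.unit
  exact ContinuousAt.comp (f := fun p : X × ℂ => algebraMap ℂ 𝔸 p.2 - a p.1) (x := (x, z)) h2 h1

theorem eventually_mem_resolventSet_prod [CompleteSpace 𝔸] {X : Type*} [TopologicalSpace X]
    {a : X → 𝔸} {x : X} {z : ℂ} (ha : ContinuousAt a x) (hz : z ∈ resolventSet ℂ (a x)) :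
    ∀ᶠ p : X × ℂ in 𝓝 (x, z), p.2 ∈ resolventSet ℂ (a p.1) := by
  have h1 : ContinuousAt (fun p : X × ℂ => algebraMap ℂ 𝔸 p.2 - a p.1) (x, z) :=
    ((continuous_algebraMap ℂ 𝔸).comp continuous_snd).continuousAt.sub
      (ContinuousAt.comp (f := Prod.fst) (x := (x, z)) ha continuousAt_fst)
  exact h1.eventually (Units.isOpen.mem_nhds hz)

/-- Near a parameter `x`, the resolvents of `a y` exist and are uniformly bounded on any compact
subset of the resolvent set of `a x`. -/
theorem exists_resolvent_bound [CompleteSpace 𝔸] {X : Type*} [TopologicalSpace X] {a : X → 𝔸}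
    {x : X} {K : Set ℂ} (hK : IsCompact K) (ha : ContinuousAt a x) (hx : K ⊆ resolventSet ℂ (a x)) :
    ∃ C : ℝ, ∀ᶠ y in 𝓝 x, ∀ z ∈ K, z ∈ resolventSet ℂ (a y) ∧ ‖resolvent (a y) z‖ ≤ C := by
  have hc : ContinuousOn (fun z => ‖resolvent (a x) z‖) K := fun z hz =>
    (spectrum.hasDerivAt_resolvent_const_left (hx hz)).continuousAt.norm.continuousWithinAt
  obtain ⟨C, hC⟩ := hK.bddAbove_image hc
  refine ⟨C + 1, hK.eventually_forall_of_forall_eventually fun z hz => ?_⟩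
  have h1 := (continuousAt_resolvent_prod ha (hx hz)).norm
  have h2 : ‖resolvent (a x) z‖ < C + 1 := by
    have := hC (Set.mem_image_of_mem _ hz)
    linarith
  filter_upwards [eventually_mem_resolventSet_prod ha (hx hz), h1.eventually_lt_const h2]
    with p hp hp' using ⟨hp, hp'.le⟩

variable {a : 𝔸} {r : ℝ}

theorem continuousOn_resolvent [CompleteSpace 𝔸] {K : Set ℂ} (h : K ⊆ resolventSet ℂ a) :
    ContinuousOn (resolvent a) K := fun _ hz =>
  (spectrum.hasDerivAt_resolvent_const_left (h hz)).continuousAt.continuousWithinAt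

theorem continuousOn_zpow_smul_resolvent [CompleteSpace 𝔸] (hr : 0 < r)
    (h : sphere 0 r ⊆ resolventSet ℂ a) (k : ℤ) :
    ContinuousOn (fun z : ℂ => z ^ k • resolvent a z) (sphere 0 r) :=
  (continuousOn_id.zpow₀ k fun _ hz => Or.inl (ne_of_mem_sphere hz hr.ne')).smul
    (continuousOn_resolvent h)

theorem norm_rieszMoment_le (hr : 0 < r) {C : ℝ} (h : ∀ z ∈ sphere (0 : ℂ) r, ‖resolvent a z‖ ≤ C)
    (k : ℤ) : ‖rieszMoment a r k‖ ≤ r * (r ^ k * C) := by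
  refine circleIntegral.norm_two_pi_i_inv_smul_integral_le_of_norm_le_const hr.le fun z hz => ?_
  rw [norm_smul, norm_zpow, mem_sphere_zero_iff_norm.1 hz]
  exact mul_le_mul_of_nonneg_left (h z hz) (by positivity)

theorem circleIntegral_zpow (hr : 0 < r) (k : ℤ) :
    (2 * (Real.pi : ℂ) * Complex.I)⁻¹ * (∮ z in C(0, r), z ^ k) = if k = -1 then 1 else 0 := by
  split_ifs with hk
  · have := circleIntegral.integral_sub_center_inv 0 hr.ne'
    simp only [sub_zero] at this
    simp only [hk, zpow_neg_one, this]
    exact inv_mul_cancel₀ Complex.two_pi_I_ne_zero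
  · have := circleIntegral.integral_sub_zpow_of_ne hk 0 0 r
    simp only [sub_zero] at this
    rw [this, mul_zero]

variable [CompleteSpace 𝔸]

theorem mul_rieszMoment (hr : 0 < r) (h : sphere 0 r ⊆ resolventSet ℂ a) (k : ℤ) :
    a * rieszMoment a r k = rieszMoment a r (k + 1) - if k = -1 then 1 else 0 := by
  have hi := (continuousOn_zpow_smul_resolvent hr h k).circleIntegrable hr.le
  have hi' := (continuousOn_zpow_smul_resolvent hr h (k + 1)).circleIntegrable hr.le
  have h1 : a * (∮ z in C(0, r), z ^ k • resolvent a z) =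
      ∮ z in C(0, r), a * (z ^ k • resolvent a z) :=
    ((ContinuousLinearMap.mul ℂ 𝔸 a).circleIntegral_comp_comm hi).symm
  have h2 : (∮ z in C(0, r), a * (z ^ k • resolvent a z)) =
      ∮ z in C(0, r), (z ^ (k + 1) • resolvent a z - z ^ k • (1 : 𝔸)) := by
    refine circleIntegral.integral_congr hr.le fun z hz => ?_
    have hz0 : z ≠ 0 := ne_of_mem_sphere hz hr.ne'
    simp only [mul_smul_comm, mul_resolvent (h hz), smul_sub, smul_smul, zpow_add_one₀ hz0]
  have h3 : CircleIntegrable (fun z : ℂ => z ^ k • (1 : 𝔸)) 0 r :=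
    ContinuousOn.circleIntegrable hr.le
      ((continuousOn_id.zpow₀ k fun _ hz => Or.inl (ne_of_mem_sphere hz hr.ne')).smul
        continuousOn_const)
  rw [rieszMoment, mul_smul_comm, h1, h2, circleIntegral.integral_sub hi' h3, smul_sub,
    circleIntegral.integral_smul_const, smul_smul, circleIntegral_zpow hr, rieszMoment]
  split_ifs <;> simp

theorem pow_mul_rieszMoment_zero (hr : 0 < r) (h : sphere 0 r ⊆ resolventSet ℂ a) (n : ℕ) :
    a ^ n * rieszMoment a r 0 = rieszMoment a r n := by
  induction n with
  | zero => simp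
  | succ n ih =>
    rw [pow_succ', mul_assoc, ih, mul_rieszMoment hr h, if_neg (by omega), sub_zero]
    push_cast; rfl

/-- The moments of negative order invert the powers of `a` on the complementary spectral subspace:
the only term the recursion picks up on the way to order `0` is the residue at the origin. -/
theorem pow_mul_rieszMoment_neg (hr : 0 < r) (h : sphere 0 r ⊆ resolventSet ℂ a) (n : ℕ) :
    a ^ (n + 1) * rieszMoment a r (-(n + 1 : ℕ)) = rieszMoment a r 0 - 1 := by
  induction n with
  | zero => simpa using mul_rieszMoment hr h (-1)
  | succ n ih =>
    rw [pow_succ, mul_assoc, mul_rieszMoment hr h, if_neg (by push_cast; omega), sub_zero, ← ih]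
    congr 2

theorem commute_rieszMoment (hr : 0 < r) (h : sphere 0 r ⊆ resolventSet ℂ a) (k : ℤ) :
    Commute a (rieszMoment a r k) := by
  have hi := (continuousOn_zpow_smul_resolvent hr h k).circleIntegrable hr.le
  have h1 : a * (∮ z in C(0, r), z ^ k • resolvent a z) =
      ∮ z in C(0, r), a * (z ^ k • resolvent a z) :=
    ((ContinuousLinearMap.mul ℂ 𝔸 a).circleIntegral_comp_comm hi).symm
  have h2 : (∮ z in C(0, r), z ^ k • resolvent a z) * a =
      ∮ z in C(0, r), (z ^ k • resolvent a z) * a :=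
    (((ContinuousLinearMap.mul ℂ 𝔸).flip a).circleIntegral_comp_comm hi).symm
  have h3 : (∮ z in C(0, r), a * (z ^ k • resolvent a z)) =
      ∮ z in C(0, r), (z ^ k • resolvent a z) * a := by
    refine circleIntegral.integral_congr hr.le fun z hz => ?_
    simp only [mul_smul_comm, smul_mul_assoc, mul_resolvent (h hz), resolvent_mul (h hz)]
  rw [commute_iff_eq, rieszMoment, mul_smul_comm, smul_mul_assoc, h1, h2, h3]

theorem rieszMoment_zero_eq_of_annulus {r₁ r₂ : ℝ} (hr : 0 < r₁) (hle : r₁ ≤ r₂)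
    (h : closedBall 0 r₂ \ ball 0 r₁ ⊆ resolventSet ℂ a) :
    rieszMoment a r₂ 0 = rieszMoment a r₁ 0 := by
  simp only [rieszMoment, zpow_zero, one_smul]
  congr 1
  refine Complex.circleIntegral_eq_of_differentiable_on_annulus_off_countable hr hle
    Set.countable_empty (continuousOn_resolvent h) fun z hz => ?_
  refine (spectrum.hasDerivAt_resolvent_const_left (h ⟨?_, ?_⟩)).differentiableAt
  · exact ball_subset_closedBall hz.1.1
  · exact fun hz' => hz.1.2 (ball_subset_closedBall hz')

/-- The Riesz projection is idempotent. With `p` the projection, `p (1 - p)` equals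
`-(aⁿ p) (a⁻ⁿ (1 - p))` for every `n`; computing the first factor on a smaller and the second on a
larger circle shows that the product tends to `0`. -/
theorem rieszMoment_zero_mul_one_sub {r₁ r₂ : ℝ} (hr : 0 < r₁) (hlt : r₁ < r₂)
    (h : closedBall 0 r₂ \ ball 0 r₁ ⊆ resolventSet ℂ a) :
    rieszMoment a r₁ 0 * (1 - rieszMoment a r₁ 0) = 0 := by
  have hs₁ : sphere (0 : ℂ) r₁ ⊆ closedBall 0 r₂ \ ball 0 r₁ := fun z hz => by
    rw [mem_sphere_zero_iff_norm] at hz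
    simp [hz, hlt.le]
  have hs₂ : sphere (0 : ℂ) r₂ ⊆ closedBall 0 r₂ \ ball 0 r₁ := fun z hz => by
    rw [mem_sphere_zero_iff_norm] at hz
    simp [hz, hlt.le]
  have hr₂ : 0 < r₂ := hr.trans hlt
  obtain ⟨C₁, hC₁⟩ := (isCompact_sphere (0 : ℂ) r₁).bddAbove_image
    (continuousOn_resolvent (hs₁.trans h)).norm
  obtain ⟨C₂, hC₂⟩ := (isCompact_sphere (0 : ℂ) r₂).bddAbove_image
    (continuousOn_resolvent (hs₂.trans h)).norm
  have key : ∀ n : ℕ, ‖rieszMoment a r₁ 0 * (1 - rieszMoment a r₁ 0)‖ ≤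
      (r₁ * C₁) * (r₂ * C₂) * (r₁ / r₂) ^ (n + 1) := by
    intro n
    have e : rieszMoment a r₁ 0 * (1 - rieszMoment a r₁ 0) =
        -(rieszMoment a r₁ (n + 1 : ℕ) * rieszMoment a r₂ (-(n + 1 : ℕ))) := by
      rw [← pow_mul_rieszMoment_zero hr (hs₁.trans h),
        ((commute_rieszMoment hr (hs₁.trans h) 0).pow_left (n + 1)).eq, mul_assoc,
        pow_mul_rieszMoment_neg hr₂ (hs₂.trans h), rieszMoment_zero_eq_of_annulus hr hlt.le h,
        ← mul_neg, neg_sub]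
    rw [e, norm_neg]
    refine (norm_mul_le _ _).trans ?_
    have b₁ := norm_rieszMoment_le hr (fun z hz => hC₁ (Set.mem_image_of_mem _ hz)) (n + 1 : ℕ)
    have b₂ := norm_rieszMoment_le hr₂ (fun z hz => hC₂ (Set.mem_image_of_mem _ hz)) (-(n + 1 : ℕ))
    refine (mul_le_mul b₁ b₂ (norm_nonneg _) ((norm_nonneg _).trans b₁)).trans_eq ?_
    rw [zpow_neg, zpow_natCast, zpow_natCast, div_pow]
    field_simp
  have lim : Tendsto (fun n : ℕ => (r₁ * C₁) * (r₂ * C₂) * (r₁ / r₂) ^ (n + 1)) atTop (𝓝 0) := by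
    have := (tendsto_pow_atTop_nhds_zero_of_lt_one (by positivity)
      ((div_lt_one hr₂).2 hlt)).comp (tendsto_add_atTop_nat 1)
    simpa using this.const_mul ((r₁ * C₁) * (r₂ * C₂))
  exact norm_le_zero_iff.1 (ge_of_tendsto' lim key)

/-- The Riesz projection depends holomorphically on the parameter: by the resolvent identity its
difference quotients are contour integrals of integrands that converge uniformly. -/
theorem differentiableAt_rieszMoment_zero {b : ℂ → 𝔸} {x : ℂ} (hr : 0 < r)
    (hb : DifferentiableAt ℂ b x) (h : sphere 0 r ⊆ resolventSet ℂ (b x)) :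
    DifferentiableAt ℂ (fun y => rieszMoment (b y) r 0) x := by
  set b' := deriv b x
  have hres : ∀ᶠ y in 𝓝 x, sphere 0 r ⊆ resolventSet ℂ (b y) := by
    obtain ⟨C, hC⟩ := exists_resolvent_bound (isCompact_sphere 0 r) hb.continuousAt h
    filter_upwards [hC] with y hy z hz using (hy z hz).1
  set F : ℂ → ℂ → 𝔸 := fun y z => resolvent (b y) z * slope b x y * resolvent (b x) z
  have hF : TendstoUniformlyOn F (fun z => resolvent (b x) z * b' * resolvent (b x) z) (𝓝[≠] x)
      (sphere 0 r) := by
    rw [← tendstoLocallyUniformlyOn_iff_tendstoUniformlyOn_of_compact (isCompact_sphere 0 r),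
      tendstoLocallyUniformlyOn_iff_forall_tendsto]
    intro z hz
    have hle : 𝓝[sphere 0 r] z ≤ 𝓝 z := nhdsWithin_le_nhds
    have c1 : Tendsto (fun p : ℂ × ℂ => resolvent (b p.1) p.2) (𝓝[≠] x ×ˢ 𝓝[sphere 0 r] z)
        (𝓝 (resolvent (b x) z)) := by
      refine (continuousAt_resolvent_prod hb.continuousAt (h hz)).tendsto.mono_left ?_
      rw [nhds_prod_eq]
      exact Filter.prod_mono nhdsWithin_le_nhds hle
    have c2 : Tendsto (fun p : ℂ × ℂ => resolvent (b x) p.2) (𝓝[≠] x ×ˢ 𝓝[sphere 0 r] z)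
        (𝓝 (resolvent (b x) z)) :=
      (spectrum.hasDerivAt_resolvent_const_left (h hz)).continuousAt.tendsto.comp
        (tendsto_snd.mono_right hle)
    have c3 : Tendsto (fun p : ℂ × ℂ => slope b x p.1) (𝓝[≠] x ×ˢ 𝓝[sphere 0 r] z) (𝓝 b') :=
      (hasDerivAt_iff_tendsto_slope.1 hb.hasDerivAt).comp tendsto_fst
    exact (((c2.mul_const b').mul c2).prodMk_nhds ((c1.mul c3).mul c2)).mono_right
      (nhds_le_uniformity _)
  have hlim := hF.tendsto_circleIntegral_of_continuousOn hr.le (by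
    filter_upwards [hres.filter_mono nhdsWithin_le_nhds] with y hy
    exact ((continuousOn_resolvent hy).mul continuousOn_const).mul (continuousOn_resolvent h))
  refine (hasDerivAt_iff_tendsto_slope.2
    ((hlim.const_smul (2 * (Real.pi : ℂ) * Complex.I)⁻¹).congr' ?_)).differentiableAt
  filter_upwards [hres.filter_mono nhdsWithin_le_nhds] with y hy
  simp only [slope, vsub_eq_sub, rieszMoment, zpow_zero, one_smul]
  rw [← smul_sub, ← circleIntegral.integral_sub
    ((continuousOn_resolvent hy).circleIntegrable hr.le)
    ((continuousOn_resolvent h).circleIntegrable hr.le), smul_comm,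
    ← circleIntegral.integral_smul (y - x)⁻¹]
  congr 1
  refine circleIntegral.integral_congr hr.le fun z hz => ?_
  simp only [F, slope, vsub_eq_sub, spectrum.resolvent_sub_resolvent (hy hz) (h hz),
    mul_smul_comm, smul_mul_assoc]

end BanachAlgebra

end BlockToeplitz

/-! ### Counting zeros under locally uniform convergence -/

namespace BlockToeplitz

open Filter Topology Metric Polynomial

theorem circleIntegral_sub_inv_of_notMem_closedBall {c w : ℂ} {r : ℝ} (hr : 0 ≤ r)
    (hw : w ∉ closedBall c r) : (∮ z in C(c, r), (z - w)⁻¹) = 0 := by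
  refine DiffContOnCl.circleIntegral_eq_zero hr (DifferentiableOn.diffContOnCl ?_)
  refine DifferentiableOn.inv (by fun_prop) fun z hz h => hw ?_
  rw [← sub_eq_zero.1 h]
  exact closure_ball_subset_closedBall hz

open Classical in
/-- The sum `∑ (z - w)⁻¹` is the logarithmic derivative of `∏ (z - w)`; its contour integral counts
the points `w` inside the circle. -/
theorem circleIntegral_multiset_sum_sub_inv {c : ℂ} {r : ℝ} (hr : 0 ≤ r) (s : Multiset ℂ)
    (hs : ∀ w ∈ s, w ∉ sphere c r) :
    CircleIntegrable (fun z => (s.map fun w => (z - w)⁻¹).sum) c r ∧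
    (∮ z in C(c, r), (s.map fun w => (z - w)⁻¹).sum) =
      2 * Real.pi * Complex.I * (s.countP (· ∈ ball c r) : ℕ) := by
  induction s using Multiset.induction_on with
  | empty => simp [circleIntegral]
  | cons w s ih =>
    obtain ⟨ih1, ih2⟩ := ih fun v hv => hs v (Multiset.mem_cons_of_mem hv)
    have hw := hs w (Multiset.mem_cons_self w s)
    have hi : CircleIntegrable (fun z => (z - w)⁻¹) c r := by
      refine ContinuousOn.circleIntegrable hr (ContinuousOn.inv₀ (by fun_prop) fun z hz h => hw ?_)
      rwa [← sub_eq_zero.1 h]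
    simp only [Multiset.map_cons, Multiset.sum_cons]
    refine ⟨hi.add ih1, ?_⟩
    rw [circleIntegral.integral_add hi ih1, ih2]
    by_cases hb : w ∈ ball c r
    · rw [circleIntegral.integral_sub_inv_of_mem_ball hb, Multiset.countP_cons_of_pos _ hb]
      push_cast; ring
    · rw [circleIntegral_sub_inv_of_notMem_closedBall hr, Multiset.countP_cons_of_neg _ hb,
        zero_add]
      rw [← ball_union_sphere]
      exact fun h => h.elim hb hw

open Classical in
/-- The argument principle for a polynomial times a zero-free holomorphic function. -/
theorem circleIntegral_deriv_div_eq_countP {c : ℂ} {r : ℝ} (hr : 0 < r) {U : Set ℂ} (hU : IsOpen U)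
    (hcU : closedBall c r ⊆ U) {f g : ℂ → ℂ} {p : ℂ[X]} (hg : DifferentiableOn ℂ g U)
    (hg0 : ∀ z ∈ U, g z ≠ 0) (hf : ∀ z ∈ U, f z = p.eval z * g z)
    (hf0 : ∀ z ∈ sphere c r, f z ≠ 0) :
    (∮ z in C(c, r), deriv f z / f z) =
      2 * Real.pi * Complex.I * (p.roots.countP (· ∈ ball c r) : ℕ) := by
  have hsU : sphere c r ⊆ U := sphere_subset_closedBall.trans hcU
  have hp0 : ∀ z ∈ sphere c r, p.eval z ≠ 0 := fun z hz h =>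
    hf0 z hz (by rw [hf z (hsU hz), h, zero_mul])
  have hroots : ∀ w ∈ p.roots, w ∉ sphere c r := fun w hw hws =>
    hp0 w hws (isRoot_of_mem_roots hw)
  obtain ⟨h1, h2⟩ := circleIntegral_multiset_sum_sub_inv hr.le p.roots hroots
  have hdg : DifferentiableOn ℂ (fun z => deriv g z / g z) U :=
    (hg.deriv hU).div hg hg0
  have h3 : (∮ z in C(c, r), deriv g z / g z) = 0 := by
    refine DiffContOnCl.circleIntegral_eq_zero hr.le (DifferentiableOn.diffContOnCl ?_)
    exact hdg.mono (closure_ball_subset_closedBall.trans hcU)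
  rw [← h2, ← add_zero (∮ z in C(c, r), (p.roots.map fun w => (z - w)⁻¹).sum), ← h3,
    ← circleIntegral.integral_add h1 ((hdg.continuousOn.mono hsU).circleIntegrable hr.le)]
  refine circleIntegral.integral_congr hr.le fun z hz => ?_
  have hzU := hsU hz
  have hfe : f =ᶠ[𝓝 z] fun z => p.eval z * g z := by
    filter_upwards [hU.mem_nhds hzU] with y hy using hf y hy
  have hd : deriv f z = p.derivative.eval z * g z + p.eval z * deriv g z := by
    rw [hfe.deriv_eq]
    exact ((p.hasDerivAt z).mul (hg.differentiableAt (hU.mem_nhds hzU)).hasDerivAt).deriv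
  have hpz := hp0 z hz
  have hgz := hg0 z hzU
  have hlog := (IsAlgClosed.splits p).eval_derivative_div_eval_of_ne_zero hpz
  simp only [one_div] at hlog
  rw [← hlog, hd, hf z hzU]
  field_simp

open Classical in
/-- **Hurwitz's theorem**, for functions that are polynomials up to zero-free holomorphic factors:
if `pᵢ gᵢ` converges locally uniformly to `p g` and `p` has no zero on the circle, then eventually
`pᵢ` and `p` have the same number of zeros inside. -/
theorem eventually_countP_roots_eq {ι : Type*} {l : Filter ι} [l.NeBot] [l.IsCountablyGenerated]
    {c : ℂ} {r : ℝ} (hr : 0 < r) {U : Set ℂ} (hU : IsOpen U) (hcU : closedBall c r ⊆ U)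
    {f : ι → ℂ → ℂ} {g : ι → ℂ → ℂ} {p : ι → ℂ[X]} {f₀ g₀ : ℂ → ℂ} {p₀ : ℂ[X]}
    (hlim : ∀ x ∈ U, Tendsto (fun y : ι × ℂ => f y.1 y.2) (l ×ˢ 𝓝 x) (𝓝 (f₀ x)))
    (hg : ∀ᶠ i in l, DifferentiableOn ℂ (g i) U ∧ (∀ z ∈ U, g i z ≠ 0) ∧
      ∀ z ∈ U, f i z = (p i).eval z * g i z)
    (hg₀ : DifferentiableOn ℂ g₀ U) (hg₀0 : ∀ z ∈ U, g₀ z ≠ 0)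
    (hf₀ : ∀ z ∈ U, f₀ z = p₀.eval z * g₀ z) (hp₀ : ∀ z ∈ sphere c r, p₀.eval z ≠ 0) :
    ∀ᶠ i in l, (p i).roots.countP (· ∈ ball c r) = p₀.roots.countP (· ∈ ball c r) := by
  have hsU : sphere c r ⊆ U := sphere_subset_closedBall.trans hcU
  have hdf₀ : DifferentiableOn ℂ f₀ U :=
    (p₀.differentiable.differentiableOn.mul hg₀).congr hf₀
  have hf₀0 : ∀ z ∈ sphere c r, f₀ z ≠ 0 := fun z hz => by
    rw [hf₀ z (hsU hz)]
    exact mul_ne_zero (hp₀ z hz) (hg₀0 z (hsU hz))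
  have hdf : ∀ᶠ i in l, DifferentiableOn ℂ (f i) U := by
    filter_upwards [hg] with i hi
    exact ((p i).differentiable.differentiableOn.mul hi.1).congr hi.2.2
  have hloc : TendstoLocallyUniformlyOn f f₀ l U := by
    rw [hU.tendstoLocallyUniformlyOn_iff_forall_tendsto]
    intro x hx
    have hc := (hdf₀.continuousOn.continuousAt (hU.mem_nhds hx)).tendsto
    exact ((hc.comp tendsto_snd).prodMk_nhds (hlim x hx)).mono_right (nhds_le_uniformity _)
  have hdlim : ∀ x ∈ U, Tendsto (fun y : ι × ℂ => deriv (f y.1) y.2) (l ×ˢ 𝓝 x)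
      (𝓝 (deriv f₀ x)) := by
    intro x hx
    have h1 := hU.tendstoLocallyUniformlyOn_iff_forall_tendsto.1 (hloc.deriv hdf hU) x hx
    have hc := (((hdf₀.deriv hU).continuousOn.continuousAt (hU.mem_nhds hx)).tendsto).comp
      (tendsto_snd (f := l))
    exact hc.congr_uniformity h1
  have hne : ∀ᶠ i in l, ∀ z ∈ sphere c r, f i z ≠ 0 := by
    have : ∀ z ∈ sphere c r, ∀ᶠ y : ι × ℂ in l ×ˢ 𝓝 z, f y.1 y.2 ≠ 0 := fun z hz =>
      (hlim z (hsU hz)).eventually_ne (hf₀0 z hz)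
    have h2 : ∀ᶠ y : ι × ℂ in l ×ˢ 𝓝ˢ (sphere c r), f y.1 y.2 ≠ 0 := by
      rw [(isCompact_sphere c r).prod_nhdsSet_eq_biSup]
      simpa only [eventually_iSup] using this
    exact h2.curry.mono fun _ h => h.self_of_nhdsSet
  have hratio : TendstoUniformlyOn (fun i z => deriv (f i) z / f i z)
      (fun z => deriv f₀ z / f₀ z) l (sphere c r) := by
    rw [← tendstoLocallyUniformlyOn_iff_tendstoUniformlyOn_of_compact (isCompact_sphere c r),
      tendstoLocallyUniformlyOn_iff_forall_tendsto]
    intro z hz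
    have hzU := hU.mem_nhds (hsU hz)
    have hc : ContinuousAt (fun z => deriv f₀ z / f₀ z) z :=
      ((hdf₀.deriv hU).continuousOn.continuousAt hzU).div
        (hdf₀.continuousOn.continuousAt hzU) (hf₀0 z hz)
    have ht := (hdlim z (hsU hz)).div (hlim z (hsU hz)) (hf₀0 z hz)
    exact (((hc.tendsto.comp tendsto_snd).prodMk_nhds ht).mono_right
      (nhds_le_uniformity _)).mono_left (Filter.prod_mono le_rfl nhdsWithin_le_nhds)
  have hint := hratio.tendsto_circleIntegral_of_continuousOn hr.le (by
    filter_upwards [hdf, hne] with i h1 h2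
    exact ((h1.deriv hU).continuousOn.mono hsU).div (h1.continuousOn.mono hsU) h2)
  rw [circleIntegral_deriv_div_eq_countP hr hU hcU hg₀ hg₀0 hf₀ hf₀0] at hint
  have hcount : Tendsto (fun i => (((p i).roots.countP (· ∈ ball c r) : ℕ) : ℂ)) l
      (𝓝 ((p₀.roots.countP (· ∈ ball c r) : ℕ) : ℂ)) := by
    have h4 := hint.const_mul (2 * (Real.pi : ℂ) * Complex.I)⁻¹
    rw [inv_mul_cancel_left₀ Complex.two_pi_I_ne_zero] at h4
    refine h4.congr' ?_
    filter_upwards [hg, hne] with i hi h2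
    rw [circleIntegral_deriv_div_eq_countP hr hU hcU hi.1 hi.2.1 hi.2.2 h2,
      inv_mul_cancel_left₀ Complex.two_pi_I_ne_zero]
  -- Convergent sequences of integers are eventually constant.
  have hev := hcount.eventually (Metric.ball_mem_nhds _ one_pos)
  filter_upwards [hev] with i hi
  have h5 : |((((p i).roots.countP (· ∈ ball c r) : ℕ) : ℝ) -
      ((p₀.roots.countP (· ∈ ball c r) : ℕ) : ℝ))| < 1 := by
    replace hi : dist _ _ < 1 := hi
    rw [dist_eq_norm] at hi
    rw [← Real.norm_eq_abs, ← Complex.norm_real]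
    simpa using hi
  have h6 : |((((p i).roots.countP (· ∈ ball c r) : ℕ) : ℤ) -
      ((p₀.roots.countP (· ∈ ball c r) : ℕ) : ℤ))| < 1 := by exact_mod_cast h5
  have := Int.abs_lt_one_iff.1 h6
  omega

end BlockToeplitz

/-! ### The spectral gap of the transfer matrix -/

namespace BlockToeplitz

open Filter Topology Metric Polynomial

section SortedLists

variable {l : List ℂ} {k : ℕ} {s : ℝ}

open Classical in
theorem countP_ball_eq_of_gap (hl : l.Pairwise fun z w => ‖z‖ ≤ ‖w‖) (hk : k + 1 < l.length)
    (h₁ : ‖l.getD k 0‖ < s) (h₂ : s ≤ ‖l.getD (k + 1) 0‖) :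
    (l : Multiset ℂ).countP (· ∈ ball 0 s) = k + 1 := by
  rw [List.getD_eq_getElem _ _ (by omega)] at h₁ h₂
  rw [List.pairwise_iff_getElem] at hl
  rw [Multiset.coe_countP, ← List.take_append_drop (k + 1) l, List.countP_append,
    List.countP_eq_length.2, List.countP_eq_zero.2, List.length_take]
  · omega
  · intro z hz
    obtain ⟨i, hi, rfl⟩ := List.mem_iff_getElem.1 hz
    rw [List.length_drop] at hi
    have : ‖l[k + 1]‖ ≤ ‖l[k + 1 + i]‖ := by
      rcases Nat.eq_zero_or_pos i with rfl | hi0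
      · rfl
      · exact hl _ _ _ _ (by omega)
    simpa using h₂.trans this
  · intro z hz
    obtain ⟨i, hi, rfl⟩ := List.mem_iff_getElem.1 hz
    rw [List.length_take] at hi
    have : ‖l[i]‖ ≤ ‖l[k]‖ := by
      rcases Nat.lt_or_ge i k with hik | hik
      · exact hl _ _ _ _ hik
      · obtain rfl : i = k := by omega
        rfl
    simpa using this.trans_lt h₁

open Classical in
theorem gap_of_countP_ball_eq (hl : l.Pairwise fun z w => ‖z‖ ≤ ‖w‖) (hk : k + 1 < l.length)
    (h : (l : Multiset ℂ).countP (· ∈ ball 0 s) = k + 1) :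
    ‖l.getD k 0‖ < s ∧ s ≤ ‖l.getD (k + 1) 0‖ := by
  rw [List.getD_eq_getElem _ _ (by omega), List.getD_eq_getElem _ _ hk]
  rw [List.pairwise_iff_getElem] at hl
  rw [Multiset.coe_countP] at h
  constructor
  · by_contra! hs
    have h1 : (l.drop k).countP (· ∈ ball 0 s) = 0 := by
      refine List.countP_eq_zero.2 fun z hz => ?_
      obtain ⟨i, hi, rfl⟩ := List.mem_iff_getElem.1 hz
      rw [List.length_drop] at hi
      have : ‖l[k]‖ ≤ ‖l[k + i]‖ := by
        rcases Nat.eq_zero_or_pos i with rfl | hi0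
        · rfl
        · exact hl _ _ _ _ (by omega)
      simpa using hs.trans this
    have h2 : (l.take k).countP (· ∈ ball 0 s) ≤ (l.take k).length := List.countP_le_length
    rw [← List.take_append_drop k l, List.countP_append, h1] at h
    rw [List.length_take] at h2
    omega
  · by_contra! hs
    have h1 : (l.take (k + 2)).countP (· ∈ ball 0 s) = (l.take (k + 2)).length := by
      refine List.countP_eq_length.2 fun z hz => ?_
      obtain ⟨i, hi, rfl⟩ := List.mem_iff_getElem.1 hz
      rw [List.length_take] at hi
      have : ‖l[i]‖ ≤ ‖l[k + 1]‖ := by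
        rcases Nat.lt_or_ge i (k + 1) with hik | hik
        · exact hl _ _ _ _ hik
        · obtain rfl : i = k + 1 := by omega
          rfl
      simpa using this.trans_lt hs
    rw [← List.take_append_drop (k + 2) l, List.countP_append, h1, List.length_take] at h
    omega

theorem norm_le_or_le_norm_of_mem (hl : l.Pairwise fun z w => ‖z‖ ≤ ‖w‖) (hk : k + 1 < l.length)
    {z : ℂ} (hz : z ∈ l) : ‖z‖ ≤ ‖l.getD k 0‖ ∨ ‖l.getD (k + 1) 0‖ ≤ ‖z‖ := by
  rw [List.getD_eq_getElem _ _ (by omega), List.getD_eq_getElem _ _ hk]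
  rw [List.pairwise_iff_getElem] at hl
  obtain ⟨i, hi, rfl⟩ := List.mem_iff_getElem.1 hz
  rcases lt_trichotomy i k with h | rfl | h
  · exact Or.inl (hl _ _ _ _ h)
  · exact Or.inl le_rfl
  · rcases Nat.eq_or_lt_of_le (Nat.succ_le_of_lt h) with rfl | h
    · exact Or.inr le_rfl
    · exact Or.inr (hl _ _ _ _ h)

end SortedLists

section Spectrum

variable {n : Type*} [Fintype n] [DecidableEq n]

theorem eval_charpoly_eq_det (A : Matrix n n ℂ) (z : ℂ) :
    A.charpoly.eval z = (z • (1 : Matrix n n ℂ) - A).det := by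
  rw [Matrix.eval_charpoly, Matrix.scalar_apply, Matrix.smul_one_eq_diagonal]

theorem mem_resolventSet_iff_eval_charpoly {A : Matrix n n ℂ} {z : ℂ} :
    z ∈ resolventSet ℂ A ↔ A.charpoly.eval z ≠ 0 := by
  rw [spectrum.mem_resolventSet_iff, Matrix.isUnit_iff_isUnit_det, isUnit_iff_ne_zero,
    eval_charpoly_eq_det, Algebra.algebraMap_eq_smul_one]

theorem eval_charpoly_ne_zero_iff {A : Matrix n n ℂ} {z : ℂ} :
    A.charpoly.eval z ≠ 0 ↔ z ∉ orderedEigenvalues A := by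
  rw [← Multiset.mem_coe, coe_orderedEigenvalues, mem_roots A.charpoly_monic.ne_zero, IsRoot.def]

open Classical in
/-- The number of eigenvalues in a disc whose boundary carries none is locally constant. -/
theorem eventually_countP_charpoly_roots_eq {X : Type*} [TopologicalSpace X]
    [FirstCountableTopology X] {A : X → Matrix n n ℂ} {x : X} (hA : Continuous A) {c : ℂ} {r : ℝ}
    (hr : 0 < r) (h : ∀ z ∈ sphere c r, (A x).charpoly.eval z ≠ 0) :
    ∀ᶠ y in 𝓝 x, (A y).charpoly.roots.countP (· ∈ ball c r) =
      (A x).charpoly.roots.countP (· ∈ ball c r) := by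
  have hc : Continuous fun p : X × ℂ => (A p.1).charpoly.eval p.2 := by
    simp only [eval_charpoly_eq_det]
    refine Continuous.matrix_det ?_
    exact (continuous_snd.smul continuous_const).sub (hA.comp continuous_fst)
  refine eventually_countP_roots_eq (f := fun y z => (A y).charpoly.eval z)
    (g := fun _ _ => 1) (g₀ := fun _ => 1) hr isOpen_univ (Set.subset_univ _)
    (f₀ := fun z => (A x).charpoly.eval z) ?_ ?_ (differentiableOn_const _) ?_ ?_ h
  · intro z _
    have := (hc.continuousAt (x := (x, z))).tendsto
    rwa [nhds_prod_eq] at this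
  · exact Eventually.of_forall fun y => ⟨differentiableOn_const _, by simp, by simp⟩
  · simp
  · simp

end Spectrum

section TransferMatrix

variable {L : ℕ} (R V T : Matrix (Fin L) (Fin L) ℂ)

theorem continuous_transferMatrix : Continuous (transferMatrix R V T) := by
  unfold transferMatrix
  fun_prop

theorem eigZ_succ (E : ℂ) (l : ℕ) :
    eigZ R V T E (l + 1) = (orderedEigenvalues (transferMatrix R V T E)).getD l 0 := rfl

theorem length_orderedEigenvalues_transferMatrix (E : ℂ) :
    (orderedEigenvalues (transferMatrix R V T E)).length = L + L := by
  rw [length_orderedEigenvalues, Fintype.card_sum, Fintype.card_fin]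

variable {R V T}

theorem norm_eigZ_lt_of_notMem_setLambda (hL : 1 ≤ L) {E : ℂ} (hE : E ∉ setLambda R V T) :
    ‖eigZ R V T E L‖ < ‖eigZ R V T E (L + 1)‖ := by
  refine lt_of_le_of_ne ?_ hE
  have hlen := length_orderedEigenvalues_transferMatrix R V T E
  unfold eigZ
  rw [List.getD_eq_getElem _ _ (by omega), List.getD_eq_getElem _ _ (by omega)]
  exact List.pairwise_iff_getElem.1 (pairwise_orderedEigenvalues _) _ _ _ _ (by omega)

theorem mem_resolventSet_transferMatrix (hL : 1 ≤ L) {E z : ℂ} (h₁ : ‖eigZ R V T E L‖ < ‖z‖)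
    (h₂ : ‖z‖ < ‖eigZ R V T E (L + 1)‖) : z ∈ resolventSet ℂ (transferMatrix R V T E) := by
  rw [mem_resolventSet_iff_eval_charpoly, eval_charpoly_ne_zero_iff]
  intro hz
  have hlen := length_orderedEigenvalues_transferMatrix R V T E
  obtain ⟨k, rfl⟩ : ∃ k, L = k + 1 := ⟨L - 1, by omega⟩
  rw [eigZ_succ] at h₁ h₂
  rcases norm_le_or_le_norm_of_mem (k := k) (pairwise_orderedEigenvalues _) (by omega) hz with h | h
  · exact h₁.not_ge h
  · exact h₂.not_ge h

/-- The gap between the moduli of the middle eigenvalues persists near an energy outside `Λ`. -/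
theorem exists_eventually_gap (hL : 1 ≤ L) {E₀ : ℂ} (hE₀ : E₀ ∉ setLambda R V T) :
    ∃ r₁ r₂ : ℝ, 0 < r₁ ∧ r₁ < r₂ ∧
      ∀ᶠ E in 𝓝 E₀, ‖eigZ R V T E L‖ < r₁ ∧ r₂ < ‖eigZ R V T E (L + 1)‖ := by
  classical
  have hlt := norm_eigZ_lt_of_notMem_setLambda hL hE₀
  set α := ‖eigZ R V T E₀ L‖
  set β := ‖eigZ R V T E₀ (L + 1)‖
  have hα : 0 ≤ α := norm_nonneg _
  have key : ∀ s : ℝ, α < s → s < β → ∀ᶠ E in 𝓝 E₀,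
      ‖eigZ R V T E L‖ < s ∧ s ≤ ‖eigZ R V T E (L + 1)‖ := by
    intro s h₁ h₂
    obtain ⟨k, rfl⟩ : ∃ k, L = k + 1 := ⟨L - 1, by omega⟩
    have hcount := eventually_countP_charpoly_roots_eq (c := 0) (r := s) (x := E₀)
      (continuous_transferMatrix R V T) (hα.trans_lt h₁) (fun z hz => by
        rw [mem_sphere_zero_iff_norm] at hz
        rw [← hz] at h₁ h₂
        exact mem_resolventSet_iff_eval_charpoly.1 (mem_resolventSet_transferMatrix hL h₁ h₂))
    filter_upwards [hcount] with E hEc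
    have hlen₀ := length_orderedEigenvalues_transferMatrix R V T E₀
    have hlen := length_orderedEigenvalues_transferMatrix R V T E
    rw [← coe_orderedEigenvalues, ← coe_orderedEigenvalues (transferMatrix R V T E₀),
      countP_ball_eq_of_gap (pairwise_orderedEigenvalues _) (by omega) h₁ h₂.le] at hEc
    exact gap_of_countP_ball_eq (pairwise_orderedEigenvalues _) (by omega) hEc
  refine ⟨α + (β - α) / 4, α + (β - α) / 2, by linarith, by linarith, ?_⟩
  filter_upwards [key (α + (β - α) / 4) (by linarith) (by linarith),
    key (α + 3 * (β - α) / 4) (by linarith) (by linarith)] with E h₁ h₂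
  exact ⟨h₁.1, lt_of_lt_of_le (by linarith) h₂.2⟩

attribute [local instance] Matrix.linftyOpNormedRing Matrix.linftyOpNormedAlgebra

/-- The entrywise contour integral is the one in the Banach algebra of matrices. -/
theorem rieszProj_eq_rieszMoment {n : Type*} [Fintype n] [DecidableEq n] {A : Matrix n n ℂ} {s : ℝ}
    (hs : 0 < s) (h : sphere 0 s ⊆ resolventSet ℂ A) : rieszProj A s = rieszMoment A s 0 := by
  ext i j
  let φ : Matrix n n ℂ →L[ℂ] ℂ := LinearMap.toContinuousLinearMap (Matrix.entryLinearMap ℂ ℂ i j)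
  have h1 := φ.circleIntegral_comp_comm ((continuousOn_resolvent h).circleIntegrable hs.le)
  simp only [rieszProj, Matrix.of_apply, rieszMoment, zpow_zero, one_smul, Matrix.smul_apply,
    smul_eq_mul]
  refine congrArg _ (Eq.trans ?_ h1)
  refine circleIntegral.integral_congr hs.le fun z _ => ?_
  simp only [Matrix.nonsing_inv_eq_ringInverse, resolvent, Algebra.algebraMap_eq_smul_one]
  rfl

theorem rieszI0_eq_rieszMoment (hL : 1 ≤ L) {E : ℂ} {r : ℝ} (hr : 0 < r)
    (h₁ : ‖eigZ R V T E L‖ < r) (h₂ : r < ‖eigZ R V T E (L + 1)‖) :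
    rieszI0 R V T E = rieszMoment (transferMatrix R V T E) r 0 := by
  set s := (‖eigZ R V T E L‖ + ‖eigZ R V T E (L + 1)‖) / 2 with hs
  have hs₁ : ‖eigZ R V T E L‖ < s := by rw [hs]; linarith
  have hs₂ : s < ‖eigZ R V T E (L + 1)‖ := by rw [hs]; linarith
  have hs₀ : 0 < s := (norm_nonneg _).trans_lt hs₁
  have hmem : ∀ {r₁ r₂ : ℝ}, ‖eigZ R V T E L‖ < r₁ → r₂ < ‖eigZ R V T E (L + 1)‖ →
      closedBall 0 r₂ \ ball 0 r₁ ⊆ resolventSet ℂ (transferMatrix R V T E) := by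
    intro r₁ r₂ h₁ h₂ z hz
    simp only [Set.mem_sdiff, mem_closedBall_zero_iff, mem_ball_zero_iff, not_lt] at hz
    exact mem_resolventSet_transferMatrix hL (h₁.trans_le hz.2) (hz.1.trans_lt h₂)
  rw [rieszI0, rieszProj_eq_rieszMoment hs₀]
  · rcases le_total r s with h | h
    · exact rieszMoment_zero_eq_of_annulus hr h (hmem h₁ hs₂)
    · exact (rieszMoment_zero_eq_of_annulus hs₀ h (hmem hs₁ h₂)).symm
  · intro z hz
    rw [mem_sphere_zero_iff_norm] at hz
    exact mem_resolventSet_transferMatrix hL (hz ▸ hs₁) (hz ▸ hs₂)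

end TransferMatrix

end BlockToeplitz

/-! ### The characteristic polynomial of `H_N` in terms of the transfer matrix -/

namespace BlockToeplitz

open Matrix

variable {L : ℕ} (R V T : Matrix (Fin L) (Fin L) ℂ)

/-- The restriction of a matrix-valued sequence `X 1, X 2, …` to the first `N` sites. -/
def siteStack {m : Type*} (N : ℕ) (X : ℕ → Matrix (Fin L) m ℂ) : Matrix (Fin N × Fin L) m ℂ :=
  of fun y k => X (y.1 + 1) y.2 k

/-- The coupling `-T` of the last of `N` sites to a further site. -/
def lastCoupling (N : ℕ) : Matrix (Fin N × Fin L) (Fin L) ℂ :=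
  of fun x k => if (x.1 : ℕ) + 1 = N then -T x.2 k else 0

/-- The evaluation at the first of `N` sites. -/
def firstSite (L N : ℕ) : Matrix (Fin L) (Fin N × Fin L) ℂ :=
  of fun k y => if (y.1 : ℕ) = 0 then (1 : Matrix (Fin L) (Fin L) ℂ) k y.2 else 0

/-- The matrix `E - H_N`, bordered by the coupling of the last site to a site `N + 1` and by
the evaluation at the first site. -/
noncomputable def borderedHam (N : ℕ) (E : ℂ) :
    Matrix ((Fin N × Fin L) ⊕ Fin L) ((Fin N × Fin L) ⊕ Fin L) ℂ :=
  fromBlocks (E • 1 - finiteHam R V T N) (lastCoupling T N) (firstSite L N) 0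

theorem sum_range_tridiagonal {M : Type*} [AddCommMonoid M] {N i : ℕ} (hi : i < N) (a b c : M) :
    (∑ j ∈ Finset.range N, if j = i then a else if j = i + 1 then b else if i = j + 1 then c else 0)
      = a + (if i + 1 < N then b else 0) + (if i = 0 then 0 else c) := by
  have h : ∀ j, (if j = i then a else if j = i + 1 then b else if i = j + 1 then c else 0) =
      (if j = i then a else 0) + (if j = i + 1 then b else 0) +
        (if j = i - 1 then (if i = 0 then 0 else c) else 0) := by
    intro j
    split_ifs <;> first | omega | simp
  simp only [h, Finset.sum_add_distrib, Finset.sum_ite_eq', Finset.mem_range]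
  rw [if_pos hi, if_pos (show i - 1 < N by omega)]

/-- Applied to a sequence with `X 0 = 0`, the matrix `E - H_N` together with the coupling to the
site `N + 1` gives, at each site, the defect in the three-term recurrence. The subtraction `n - 1`
does not truncate, since `siteStack` reads its argument from `n = 1` on. -/
theorem ham_mul_add_border_mul {m : Type*} [Fintype m] (X : ℕ → Matrix (Fin L) m ℂ) (hX : X 0 = 0)
    (N : ℕ) (E : ℂ) :
    (E • 1 - finiteHam R V T N) * siteStack N X + lastCoupling T N * X (N + 1) =
      siteStack N fun n => (E • 1 - V) * X n - T * X (n + 1) - R * X (n - 1) := by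
  ext ⟨i, p⟩ k
  have hrow : ∀ j : Fin N, (∑ q, (E • 1 - finiteHam R V T N) (i, p) (j, q) * X (j + 1) q k) =
      if (j : ℕ) = i then ((E • 1 - V) * X (i + 1) : Matrix (Fin L) m ℂ) p k
      else if (j : ℕ) = i + 1 then -(T * X (i + 2) : Matrix (Fin L) m ℂ) p k
      else if (i : ℕ) = j + 1 then -(R * X i : Matrix (Fin L) m ℂ) p k else 0 := by
    intro j
    have hone : ∀ q, (1 : Matrix (Fin N × Fin L) (Fin N × Fin L) ℂ) (i, p) (j, q) =
        if (j : ℕ) = i then (1 : Matrix (Fin L) (Fin L) ℂ) p q else 0 := by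
      intro q
      simp only [one_apply, Prod.mk.injEq, Fin.ext_iff]
      split_ifs <;> first | rfl | omega
    simp only [Matrix.sub_apply, Matrix.smul_apply, hone, finiteHam, of_apply,
      smul_eq_mul, Fin.ext_iff]
    split_ifs with h1 h2 h3
    · rw [Matrix.mul_apply]
      simp [h1]
    · rw [Matrix.mul_apply, ← Finset.sum_neg_distrib]
      simp [h2]
    · rw [Matrix.mul_apply, ← Finset.sum_neg_distrib]
      simp [h3]
    · simp
  have hb : (∑ q, (if (i : ℕ) + 1 = N then -T p q else 0) * X (N + 1) q k) =
      if (i : ℕ) + 1 < N then 0 else -(T * X (i + 2) : Matrix (Fin L) m ℂ) p k := by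
    have := i.isLt
    split_ifs with h1 h2
    · omega
    · rw [Matrix.mul_apply, ← Finset.sum_neg_distrib, show (i : ℕ) + 2 = N + 1 by omega]
      simp
    · simp
    · omega
  have hR : (if (i : ℕ) = 0 then 0 else -(R * X i : Matrix (Fin L) m ℂ) p k) =
      -(R * X i : Matrix (Fin L) m ℂ) p k := by
    split_ifs with h
    · rw [h, hX]; simp
    · rfl
  rw [Matrix.add_apply, Matrix.mul_apply, Matrix.mul_apply, Fintype.sum_prod_type]
  simp only [siteStack, lastCoupling, of_apply]
  rw [hb, Finset.sum_congr rfl fun j _ => hrow j]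
  rw [Fin.sum_univ_eq_sum_range (fun j => if j = (i : ℕ) then _ else if j = (i : ℕ) + 1 then _ else
    if (i : ℕ) = j + 1 then _ else 0), sum_range_tridiagonal i.isLt, hR]
  simp only [Matrix.sub_apply, Nat.add_sub_cancel]
  split_ifs <;> ring

variable {R V T}

/-- The lower left blocks of the powers of the transfer matrix solve the three-term recurrence. -/
theorem mul_transferMatrix_pow_toBlocks (hT : IsUnit T) (E : ℂ) (n : ℕ) :
    T * (transferMatrix R V T E ^ (n + 2)).toBlocks₂₁ =
      (E • 1 - V) * (transferMatrix R V T E ^ (n + 1)).toBlocks₂₁ -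
        R * (transferMatrix R V T E ^ n).toBlocks₂₁ := by
  have hT' : T * T⁻¹ = 1 := mul_nonsing_inv T ((isUnit_iff_isUnit_det T).1 hT)
  have h21 : ∀ B : Matrix (Fin L ⊕ Fin L) (Fin L ⊕ Fin L) ℂ,
      (transferMatrix R V T E * B).toBlocks₂₁ = T⁻¹ * B.toBlocks₁₁ := by
    intro B
    conv_lhs => rw [← fromBlocks_toBlocks B, transferMatrix, fromBlocks_multiply]
    simp
  have h11 : ∀ B : Matrix (Fin L ⊕ Fin L) (Fin L ⊕ Fin L) ℂ,
      (transferMatrix R V T E * B).toBlocks₁₁ =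
        (E • 1 - V) * T⁻¹ * B.toBlocks₁₁ - R * B.toBlocks₂₁ := by
    intro B
    conv_lhs => rw [← fromBlocks_toBlocks B, transferMatrix, fromBlocks_multiply]
    simp [sub_eq_add_neg]
  rw [pow_succ' _ (n + 1), h21, ← mul_assoc, hT', one_mul, pow_succ', h21, h11, mul_assoc]

/-- The blocks `Xₙ` of the powers of the transfer matrix solve the recurrence, so the bordered
matrix maps the block column `X₁, …, X_{N+1}` to the initial value `X₁ = T⁻¹`. Hence
`det (E - H_N)` is, up to an invertible factor, the determinant of the lower left block of a power
of the transfer matrix. -/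
theorem eval_charpoly_finiteHam_mul (hT : IsUnit T) {N : ℕ} (hN : 0 < N) (E : ℂ) :
    (finiteHam R V T N).charpoly.eval E * (T⁻¹).det =
      (borderedHam R V T N E).det * (transferMatrix R V T E ^ (N + 1)).toBlocks₂₁.det := by
  set X : ℕ → Matrix (Fin L) (Fin L) ℂ := fun n => (transferMatrix R V T E ^ n).toBlocks₂₁ with hX
  have hX0 : X 0 = 0 := by
    simp only [hX, pow_zero]
    rw [← fromBlocks_one, toBlocks_fromBlocks₂₁]
  have hX1 : X 1 = T⁻¹ := by simp [hX, transferMatrix]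
  have hprod : borderedHam R V T N E * fromBlocks 1 (siteStack N X) 0 (X (N + 1))
      = fromBlocks (E • 1 - finiteHam R V T N) 0
        (firstSite L N) T⁻¹ := by
    rw [borderedHam, fromBlocks_multiply]
    congr 1
    · simp
    · rw [ham_mul_add_border_mul R V T X hX0]
      ext x k
      simp only [siteStack, of_apply, hX, mul_transferMatrix_pow_toBlocks hT]
      simp
    · simp
    · ext k l
      rw [zero_mul, add_zero, Matrix.mul_apply, Fintype.sum_prod_type, ← hX1,
        Finset.sum_eq_single (⟨0, hN⟩ : Fin N)]
      · simp [firstSite, siteStack, one_apply]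
      · intro j _ hj
        have hj' : (j : ℕ) ≠ 0 := fun h => hj (Fin.ext h)
        simp [firstSite, hj']
      · simp
  have hdet := congrArg det hprod
  rw [det_mul, det_fromBlocks_zero₂₁, det_fromBlocks_zero₁₂, det_one, one_mul] at hdet
  rw [eval_charpoly_eq_det, hdet]

/-- The bordered matrix is injective: its last block row fixes `X 1 = 0`, and invertibility of `T`
propagates this along the recurrence. -/
theorem det_borderedHam_ne_zero (hT : IsUnit T) {N : ℕ} (hN : 0 < N) (E : ℂ) :
    (borderedHam R V T N E).det ≠ 0 := by
  intro h0
  obtain ⟨v, hv0, hv⟩ := exists_mulVec_eq_zero_iff.2 h0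
  refine hv0 ?_
  -- The kernel vector, read as a solution of the recurrence with `X 0 = 0`.
  set X : ℕ → Matrix (Fin L) Unit ℂ := fun n => of fun p _ =>
    if n = 0 then 0 else if h : n - 1 < N then v (Sum.inl (⟨n - 1, h⟩, p)) else v (Sum.inr p)
    with hX
  have hX0 : X 0 = 0 := by ext; simp [hX]
  have hXl : ∀ (y : Fin N × Fin L) k, X (y.1 + 1) y.2 k = v (Sum.inl y) := by
    intro y k; simp [hX]
  have hXr : ∀ p k, X (N + 1) p k = v (Sum.inr p) := by intro p k; simp [hX]
  rw [borderedHam, fromBlocks_mulVec] at hv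
  have hrec : ∀ i < N, T * X (i + 2) = (E • 1 - V) * X (i + 1) - R * X i := by
    intro i hi
    have key := ham_mul_add_border_mul R V T X hX0 N E
    ext p k
    have h1 := congrFun (congrFun key (⟨i, hi⟩, p)) k
    have h2 := congrFun hv (Sum.inl (⟨i, hi⟩, p))
    simp only [Sum.elim_inl, Pi.add_apply, mulVec, dotProduct, Function.comp_apply,
      Pi.zero_apply] at h2
    rw [Matrix.add_apply, Matrix.mul_apply, Matrix.mul_apply] at h1
    simp only [siteStack, of_apply, hXl, hXr] at h1
    rw [h2] at h1
    simp only [Matrix.sub_apply, Matrix.mul_apply] at h1 ⊢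
    rw [Nat.add_sub_cancel] at h1
    linear_combination h1
  have hX1 : X 1 = 0 := by
    ext p k
    have h2 := congrFun hv (Sum.inr p)
    simp only [Sum.elim_inr, Pi.add_apply, mulVec, dotProduct, Function.comp_apply, firstSite,
      of_apply, Pi.zero_apply, Matrix.zero_apply, zero_mul, Finset.sum_const_zero, add_zero,
      Fintype.sum_prod_type] at h2
    rw [Finset.sum_eq_single (⟨0, hN⟩ : Fin N)] at h2
    · have h3 := hXl (⟨0, hN⟩, p) k
      simp only [zero_add] at h3
      rw [h3]
      simpa [one_apply] using h2
    · intro j _ hj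
      have hj' : (j : ℕ) ≠ 0 := fun h => hj (Fin.ext h)
      simp [hj']
    · simp
  have hT' : T⁻¹ * T = 1 := nonsing_inv_mul T ((isUnit_iff_isUnit_det T).1 hT)
  have hzero : ∀ n ≤ N, X n = 0 ∧ X (n + 1) = 0 := by
    intro n
    induction n with
    | zero => exact fun _ => ⟨hX0, hX1⟩
    | succ n ih =>
      intro hn
      obtain ⟨h1, h2⟩ := ih (by omega)
      refine ⟨h2, ?_⟩
      have h3 := hrec n (by omega)
      rw [h1, h2, Matrix.mul_zero, Matrix.mul_zero, sub_zero] at h3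
      rw [← Matrix.one_mul (X (n + 1 + 1)), ← hT', Matrix.mul_assoc, h3, Matrix.mul_zero]
  funext x
  rcases x with y | p
  · rw [← hXl y (), (hzero _ y.1.isLt.le).2]; rfl
  · rw [← hXr p (), (hzero N le_rfl).2]; rfl

end BlockToeplitz

/-! ### Uniform decay on the spectral subspaces -/

namespace BlockToeplitz

open Filter Topology Metric

section Decay

variable {X : Type*} [TopologicalSpace X] {x : X}

theorem tendsto_zero_of_norm_le_geometric {M : Type*} [SeminormedAddCommGroup M] {F : ℕ × X → M}
    {K θ : ℝ} (hθ₀ : 0 ≤ θ) (hθ₁ : θ < 1)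
    (h : ∀ᶠ p in atTop ×ˢ 𝓝 x, ‖F p‖ ≤ K * θ ^ p.1) : Tendsto F (atTop ×ˢ 𝓝 x) (𝓝 0) := by
  refine squeeze_zero_norm' h ?_
  simpa [Function.comp_def] using
    ((tendsto_pow_atTop_nhds_zero_of_lt_one hθ₀ hθ₁).const_mul K).comp tendsto_fst

variable {𝔸 : Type*} [NormedRing 𝔸] [NormedAlgebra ℂ 𝔸] [CompleteSpace 𝔸] {a b : X → 𝔸} {r s : ℝ}

theorem tendsto_pow_mul_rieszMoment (hr : 0 < r) (hrs : r < s) (ha : ContinuousAt a x)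
    (h : sphere 0 r ⊆ resolventSet ℂ (a x)) :
    Tendsto (fun p : ℕ × X => ((s : ℂ)⁻¹) ^ p.1 • (a p.2 ^ p.1 * rieszMoment (a p.2) r 0))
      (atTop ×ˢ 𝓝 x) (𝓝 0) := by
  have hs : 0 < s := hr.trans hrs
  obtain ⟨C, hC⟩ := exists_resolvent_bound (isCompact_sphere 0 r) ha h
  refine tendsto_zero_of_norm_le_geometric (K := r * C) (θ := r / s) (by positivity)
    ((div_lt_one hs).2 hrs) ?_
  filter_upwards [tendsto_snd.eventually hC] with p hp
  rw [pow_mul_rieszMoment_zero hr fun z hz => (hp z hz).1, norm_smul, norm_pow, norm_inv,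
    Complex.norm_real, Real.norm_of_nonneg hs.le]
  have hb := norm_rieszMoment_le hr (fun z hz => (hp z hz).2) p.1
  refine (mul_le_mul_of_nonneg_left hb (by positivity)).trans_eq ?_
  rw [zpow_natCast, div_pow, inv_pow]
  ring

theorem tendsto_pow_mul_one_sub_rieszMoment (hs : 0 < s) (hsr : s < r) (ha : ContinuousAt a x)
    (h : sphere 0 r ⊆ resolventSet ℂ (a x)) (hba : ∀ y, b y * a y = 1) :
    Tendsto (fun p : ℕ × X => (s : ℂ) ^ p.1 • (b p.2 ^ p.1 * (1 - rieszMoment (a p.2) r 0)))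
      (atTop ×ˢ 𝓝 x) (𝓝 0) := by
  have hr : 0 < r := hs.trans hsr
  obtain ⟨C, hC⟩ := exists_resolvent_bound (isCompact_sphere 0 r) ha h
  refine tendsto_zero_of_norm_le_geometric (K := r * C) (θ := s / r) (by positivity)
    ((div_lt_one hr).2 hsr) ?_
  filter_upwards [tendsto_snd.eventually hC, tendsto_fst.eventually (eventually_ge_atTop 1)]
    with p hp hp1
  obtain ⟨n, hn⟩ : ∃ n, p.1 = n + 1 := ⟨p.1 - 1, by omega⟩
  have hpow : ∀ m : ℕ, b p.2 ^ m * a p.2 ^ m = 1 := by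
    intro m
    induction m with
    | zero => simp
    | succ m ih => rw [pow_succ, pow_succ', mul_assoc, ← mul_assoc (b _), hba, one_mul, ih]
  have e : b p.2 ^ p.1 * (1 - rieszMoment (a p.2) r 0) = -rieszMoment (a p.2) r (-(p.1 : ℤ)) := by
    rw [hn, ← neg_sub, ← pow_mul_rieszMoment_neg hr (fun z hz => (hp z hz).1) n, mul_neg,
      ← mul_assoc, hpow, one_mul]
  rw [e, norm_smul, norm_neg, norm_pow, Complex.norm_real, Real.norm_of_nonneg hs.le]
  have hb := norm_rieszMoment_le hr (fun z hz => (hp z hz).2) (-(p.1 : ℤ))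
  refine (mul_le_mul_of_nonneg_left hb (by positivity)).trans_eq ?_
  rw [zpow_neg, zpow_natCast, div_pow]
  ring

end Decay

/-! ### Compensated powers of the transfer matrix -/

section Ring

variable {S : Type*} [Ring S] {p m m' : S}

/-- Multiplication by `p + m⁻¹ (1 - p)` compensates the growth of `m` on the range of `1 - p`. -/
theorem compensator_mul (hm : m' * m = 1) (hpm : Commute p m) (x y : S) :
    (p + m' * (1 - p)) * (x + m * y) =
      p * x + (1 - p) * y + (m' * (1 - p)) * x + (m * p) * y := by
  have h1 : (1 - p) * m = m * (1 - p) := by rw [sub_mul, mul_sub, one_mul, mul_one, hpm.eq]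
  calc (p + m' * (1 - p)) * (x + m * y)
      = p * x + (p * m) * y + m' * (1 - p) * x + m' * ((1 - p) * m) * y := by noncomm_ring
    _ = p * x + (m * p) * y + m' * (1 - p) * x + (m' * m) * (1 - p) * y := by
        rw [h1, hpm.eq]; noncomm_ring
    _ = _ := by rw [hm]; noncomm_ring

theorem compensator_mul_inverse (hm : m' * m = 1) (hpm : Commute p m) (hp : p * (1 - p) = 0) :
    (p + m' * (1 - p)) * (p + m * (1 - p)) = 1 := by
  have hp2 : p * p = p := by
    rw [mul_sub, mul_one, sub_eq_zero] at hp
    exact hp.symm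
  have hp' : (1 - p) * p = 0 := by rw [sub_mul, one_mul, hp2, sub_self]
  rw [compensator_mul hm hpm, mul_assoc m', hp', mul_assoc m, hp, hp2, mul_sub (1 - p), hp']
  simp

end Ring

section Blocks

open Matrix

variable {ι : Type*} [Fintype ι] [DecidableEq ι]

/-- The projection onto the first block. -/
def firstProj (ι : Type*) [DecidableEq ι] : Matrix (ι ⊕ ι) (ι ⊕ ι) ℂ := fromBlocks 1 0 0 0

/-- The nilpotent map sending the second block to the first. -/
def secondToFirst (ι : Type*) [DecidableEq ι] : Matrix (ι ⊕ ι) (ι ⊕ ι) ℂ := fromBlocks 0 1 0 0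

theorem det_firstProj_add_mul (M : Matrix (ι ⊕ ι) (ι ⊕ ι) ℂ) :
    (firstProj ι + M * secondToFirst ι).det = M.toBlocks₂₁.det := by
  have h : firstProj ι + M * secondToFirst ι = fromBlocks 1 M.toBlocks₁₁ 0 M.toBlocks₂₁ := by
    conv_lhs => rw [← fromBlocks_toBlocks M, firstProj, secondToFirst, fromBlocks_multiply,
      fromBlocks_add]
    simp
  rw [h, det_fromBlocks_zero₂₁, det_one, one_mul]

/-- In block form the first factor is `[P₁₁, 1 - P₁₁; P₂₁, -P₂₁]`, which column operations turn into
`[1, P₁₁; 0, P₂₁]`. -/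
theorem det_limit_mul (P : Matrix (ι ⊕ ι) (ι ⊕ ι) ℂ) :
    (P * firstProj ι + (1 - P) * secondToFirst ι).det *
      (fromBlocks 1 1 1 0 : Matrix (ι ⊕ ι) (ι ⊕ ι) ℂ).det = P.toBlocks₂₁.det := by
  have h : (P * firstProj ι + (1 - P) * secondToFirst ι) * fromBlocks 1 1 1 0 =
      fromBlocks 1 P.toBlocks₁₁ 0 P.toBlocks₂₁ := by
    conv_lhs => rw [← fromBlocks_toBlocks P, ← fromBlocks_one, sub_eq_add_neg, fromBlocks_neg,
      fromBlocks_add, firstProj, secondToFirst, fromBlocks_multiply, fromBlocks_multiply,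
      fromBlocks_add, fromBlocks_multiply]
    simp
  rw [← det_mul, h, det_fromBlocks_zero₂₁, det_one, one_mul]

theorem det_fromBlocks_one_one_one_zero_ne_zero :
    (fromBlocks 1 1 1 0 : Matrix (ι ⊕ ι) (ι ⊕ ι) ℂ).det ≠ 0 := by
  have h : (fromBlocks 1 1 1 0 : Matrix (ι ⊕ ι) (ι ⊕ ι) ℂ) * fromBlocks 0 1 1 (-1) = 1 := by
    rw [fromBlocks_multiply, ← fromBlocks_one]
    simp
  intro h0
  have := congrArg det h
  rw [det_mul, h0, zero_mul, det_one] at this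
  exact zero_ne_one this

end Blocks

section TransferMatrix

variable {L : ℕ} (R V T : Matrix (Fin L) (Fin L) ℂ)

/-- The inverse of the transfer matrix. -/
noncomputable def transferInv (E : ℂ) : Matrix (Fin L ⊕ Fin L) (Fin L ⊕ Fin L) ℂ :=
  Matrix.fromBlocks 0 T (-R⁻¹) (R⁻¹ * (E • 1 - V))

variable {R V T}

theorem transferInv_mul (hR : IsUnit R) (hT : IsUnit T) (E : ℂ) :
    transferInv R V T E * transferMatrix R V T E = 1 := by
  have hR' : R * R⁻¹ = 1 := Matrix.mul_nonsing_inv R ((Matrix.isUnit_iff_isUnit_det R).1 hR)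
  have hT' : T⁻¹ * T = 1 := Matrix.nonsing_inv_mul T ((Matrix.isUnit_iff_isUnit_det T).1 hT)
  refine mul_eq_one_comm.1 ?_
  rw [transferInv, transferMatrix, Matrix.fromBlocks_multiply, ← Matrix.fromBlocks_one]
  congr 1
  · simp [hR']
  · rw [mul_assoc, hT', mul_one, neg_mul, ← mul_assoc, hR', one_mul, add_neg_cancel]
  · simp
  · simp [hT']

attribute [local instance] Matrix.linftyOpNormedRing Matrix.linftyOpNormedAlgebra

theorem differentiableOn_det {n : Type*} [Fintype n] [DecidableEq n] {U : Set ℂ}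
    {A : ℂ → Matrix n n ℂ} (hA : DifferentiableOn ℂ A U) :
    DifferentiableOn ℂ (fun z => (A z).det) U := by
  simp only [Matrix.det_apply]
  fun_prop

theorem differentiable_of_entries {n : Type*} [Fintype n] [DecidableEq n] {A : ℂ → Matrix n n ℂ}
    (h : ∀ i j, Differentiable ℂ fun z => A z i j) : Differentiable ℂ A :=
  differentiable_pi.2 fun i => differentiable_pi.2 (h i)

theorem differentiable_transferMatrix : Differentiable ℂ (transferMatrix R V T) := by
  refine differentiable_of_entries fun i j => ?_
  rcases i with i | i <;> rcases j with j | j <;>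
    simp only [transferMatrix, Matrix.fromBlocks_apply₁₁, Matrix.fromBlocks_apply₁₂,
      Matrix.fromBlocks_apply₂₁, Matrix.fromBlocks_apply₂₂, Matrix.mul_apply, Matrix.sub_apply,
      Matrix.smul_apply, smul_eq_mul] <;> fun_prop

theorem differentiable_transferInv : Differentiable ℂ (transferInv R V T) := by
  refine differentiable_of_entries fun i j => ?_
  rcases i with i | i <;> rcases j with j | j <;>
    simp only [transferInv, Matrix.fromBlocks_apply₁₁, Matrix.fromBlocks_apply₁₂,
      Matrix.fromBlocks_apply₂₁, Matrix.fromBlocks_apply₂₂, Matrix.mul_apply, Matrix.sub_apply,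
      Matrix.smul_apply, smul_eq_mul] <;> fun_prop

theorem differentiable_borderedHam (N : ℕ) : Differentiable ℂ (borderedHam R V T N) := by
  refine differentiable_of_entries fun i j => ?_
  rcases i with i | i <;> rcases j with j | j <;>
    simp only [borderedHam, Matrix.fromBlocks_apply₁₁, Matrix.fromBlocks_apply₁₂,
      Matrix.fromBlocks_apply₂₁, Matrix.fromBlocks_apply₂₂, Matrix.sub_apply,
      Matrix.smul_apply, smul_eq_mul] <;> fun_prop

end TransferMatrix

end BlockToeplitz

/-! ### Convergence of the compensated determinants to `q` -/

namespace BlockToeplitz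

open Filter Topology Metric Polynomial

attribute [local instance] Matrix.linftyOpNormedRing Matrix.linftyOpNormedAlgebra

variable {L : ℕ} {R V T : Matrix (Fin L) (Fin L) ℂ}

/-- The compensator `P + sⁿ 𝒯⁻ⁿ (1 - P)`, with `P` the Riesz projection of the transfer matrix `𝒯`
for the circle of radius `r`. -/
noncomputable def compensator (R V T : Matrix (Fin L) (Fin L) ℂ) (r s : ℝ) (n : ℕ) (E : ℂ) :
    Matrix (Fin L ⊕ Fin L) (Fin L ⊕ Fin L) ℂ :=
  rieszMoment (transferMatrix R V T E) r 0 +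
    ((s : ℂ) ^ n • transferInv R V T E ^ n) * (1 - rieszMoment (transferMatrix R V T E) r 0)

/-- The compensated lower left block determinant of `(s⁻¹ 𝒯)ⁿ`, as a `2L × 2L` determinant. -/
noncomputable def compensatedDet (R V T : Matrix (Fin L) (Fin L) ℂ) (r s : ℝ) (n : ℕ) (E : ℂ) : ℂ :=
  (compensator R V T r s n E * (firstProj (Fin L) +
    (((s : ℂ)⁻¹) ^ n • transferMatrix R V T E ^ n) * secondToFirst (Fin L))).det *
    (Matrix.fromBlocks 1 1 1 0 : Matrix (Fin L ⊕ Fin L) (Fin L ⊕ Fin L) ℂ).det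

theorem annulus_subset_resolventSet (hL : 1 ≤ L) {E : ℂ} {r₁ r₂ : ℝ}
    (h₁ : ‖eigZ R V T E L‖ < r₁) (h₂ : r₂ < ‖eigZ R V T E (L + 1)‖) :
    closedBall 0 r₂ \ ball 0 r₁ ⊆ resolventSet ℂ (transferMatrix R V T E) := by
  intro z hz
  simp only [Set.mem_sdiff, mem_closedBall_zero_iff, mem_ball_zero_iff, not_lt] at hz
  exact mem_resolventSet_transferMatrix hL (h₁.trans_le hz.2) (hz.1.trans_lt h₂)

theorem sphere_subset_resolventSet (hL : 1 ≤ L) {E : ℂ} {r : ℝ}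
    (h₁ : ‖eigZ R V T E L‖ < r) (h₂ : r < ‖eigZ R V T E (L + 1)‖) :
    sphere 0 r ⊆ resolventSet ℂ (transferMatrix R V T E) := by
  intro z hz
  rw [mem_sphere_zero_iff_norm] at hz
  exact mem_resolventSet_transferMatrix hL (hz ▸ h₁) (hz ▸ h₂)

theorem smul_transferInv_pow_mul (hR : IsUnit R) (hT : IsUnit T) {s : ℝ} (hs : 0 < s) (n : ℕ)
    (E : ℂ) : ((s : ℂ) ^ n • transferInv R V T E ^ n) *
      (((s : ℂ)⁻¹) ^ n • transferMatrix R V T E ^ n) = 1 := by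
  have hs' : (s : ℂ) ≠ 0 := Complex.ofReal_ne_zero.2 hs.ne'
  have hc : Commute (transferInv R V T E) (transferMatrix R V T E) := by
    rw [commute_iff_eq, transferInv_mul hR hT, mul_eq_one_comm.1 (transferInv_mul hR hT E)]
  rw [smul_mul_smul_comm, ← mul_pow, mul_inv_cancel₀ hs', one_pow, one_smul, ← hc.mul_pow,
    transferInv_mul hR hT, one_pow]

theorem det_compensator_ne_zero (hR : IsUnit R) (hT : IsUnit T) (hL : 1 ≤ L) {E : ℂ}
    {r₁ r₂ s : ℝ} (hr : 0 < r₁) (hlt : r₁ < r₂) (hs : 0 < s)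
    (h₁ : ‖eigZ R V T E L‖ < r₁) (h₂ : r₂ < ‖eigZ R V T E (L + 1)‖) (n : ℕ) :
    (compensator R V T r₁ s n E).det ≠ 0 := by
  have hcomm : Commute (rieszMoment (transferMatrix R V T E) r₁ 0)
      (((s : ℂ)⁻¹) ^ n • transferMatrix R V T E ^ n) :=
    (((commute_rieszMoment hr (sphere_subset_resolventSet hL h₁ (hlt.trans h₂)) 0).pow_left
      n).symm).smul_right _
  have h := compensator_mul_inverse (smul_transferInv_pow_mul hR hT hs n E) hcomm
    (rieszMoment_zero_mul_one_sub hr hlt (annulus_subset_resolventSet hL h₁ h₂))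
  intro h0
  have hd := congrArg Matrix.det h
  rw [Matrix.det_mul, Matrix.det_one] at hd
  rw [compensator] at h0
  rw [h0, zero_mul] at hd
  exact zero_ne_one hd

theorem compensatedDet_eq (hT : IsUnit T) {N : ℕ} (hN : 0 < N) (r s : ℝ) (E : ℂ) :
    compensatedDet R V T r s (N + 1) E = (finiteHam R V T N).charpoly.eval E *
      ((compensator R V T r s (N + 1) E).det * (borderedHam R V T N E).det⁻¹ *
        ((((s : ℂ)⁻¹) ^ (N + 1)) ^ L * (T⁻¹).det *
          (Matrix.fromBlocks 1 1 1 0 : Matrix (Fin L ⊕ Fin L) (Fin L ⊕ Fin L) ℂ).det)) := by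
  have h21 : ((((s : ℂ)⁻¹) ^ (N + 1) • transferMatrix R V T E ^ (N + 1)).toBlocks₂₁).det =
      (((s : ℂ)⁻¹) ^ (N + 1)) ^ L * (transferMatrix R V T E ^ (N + 1)).toBlocks₂₁.det := by
    have := Matrix.det_smul (transferMatrix R V T E ^ (N + 1)).toBlocks₂₁ (((s : ℂ)⁻¹) ^ (N + 1))
    rwa [Fintype.card_fin] at this
  have hb := det_borderedHam_ne_zero (R := R) (V := V) hT hN E
  have hc := eval_charpoly_finiteHam_mul (R := R) (V := V) hT hN E
  rw [compensatedDet, Matrix.det_mul, det_firstProj_add_mul, h21]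
  field_simp
  linear_combination (-(compensator R V T r s (N + 1) E).det * ((s : ℂ)⁻¹ ^ (N + 1)) ^ L *
    (Matrix.fromBlocks 1 1 1 0 : Matrix (Fin L ⊕ Fin L) (Fin L ⊕ Fin L) ℂ).det) * hc

/-- The compensated determinants converge, uniformly near each energy in the gap, to the
determinant of the lower left block of the Riesz projection. -/
theorem tendsto_compensatedDet (hR : IsUnit R) (hT : IsUnit T) (hL : 1 ≤ L) {E₀ : ℂ}
    {r₁ r₂ s : ℝ} (hr : 0 < r₁) (hs₁ : r₁ < s) (hs₂ : s < r₂)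
    (hgap : ∀ᶠ E in 𝓝 E₀, ‖eigZ R V T E L‖ < r₁ ∧ r₂ < ‖eigZ R V T E (L + 1)‖) :
    Tendsto (fun p : ℕ × ℂ => compensatedDet R V T r₁ s p.1 p.2) (atTop ×ˢ 𝓝 E₀)
      (𝓝 (qI0 R V T E₀)) := by
  set A := transferMatrix R V T
  set P : ℂ → Matrix (Fin L ⊕ Fin L) (Fin L ⊕ Fin L) ℂ := fun E => rieszMoment (A E) r₁ 0 with hP
  set π := firstProj (Fin L)
  set K := secondToFirst (Fin L)
  have hlt : r₁ < r₂ := hs₁.trans hs₂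
  obtain ⟨g₁, g₂⟩ := hgap.self_of_nhds
  have hA : ContinuousAt A E₀ := (continuous_transferMatrix R V T).continuousAt
  have hq : qI0 R V T E₀ = (P E₀ * π + (1 - P E₀) * K).det *
      (Matrix.fromBlocks 1 1 1 0 : Matrix (Fin L ⊕ Fin L) (Fin L ⊕ Fin L) ℂ).det := by
    rw [det_limit_mul, qI0, rieszI0_eq_rieszMoment hL hr g₁ (hlt.trans g₂)]
  have hPc : ContinuousAt P E₀ :=
    (differentiableAt_rieszMoment_zero hr (differentiable_transferMatrix E₀)
      (sphere_subset_resolventSet hL g₁ (hlt.trans g₂))).continuousAt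
  have t₀ : Tendsto (fun p : ℕ × ℂ => P p.2) (atTop ×ˢ 𝓝 E₀) (𝓝 (P E₀)) :=
    hPc.tendsto.comp tendsto_snd
  have t₁ := tendsto_pow_mul_rieszMoment hr hs₁ hA
    (sphere_subset_resolventSet hL g₁ (hlt.trans g₂))
  have t₂ := tendsto_pow_mul_one_sub_rieszMoment (hr.trans hs₁) hs₂ hA
    (sphere_subset_resolventSet hL (g₁.trans hlt) g₂) (transferInv_mul (V := V) hR hT)
  have t₃ := ((t₀.mul_const π).add ((t₀.const_sub 1).mul_const K)).add (t₂.mul_const π)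
    |>.add (t₁.mul_const K)
  rw [zero_mul, zero_mul, add_zero, add_zero] at t₃
  have t₄ := ((continuous_id.matrix_det.tendsto _).comp t₃).mul_const
    (Matrix.fromBlocks 1 1 1 0 : Matrix (Fin L ⊕ Fin L) (Fin L ⊕ Fin L) ℂ).det
  rw [hq]
  refine t₄.congr' ?_
  filter_upwards [tendsto_snd.eventually hgap] with p hp
  have hsub := sphere_subset_resolventSet hL hp.1 (hlt.trans hp.2)
  have hcomm : Commute (P p.2) (((s : ℂ)⁻¹) ^ p.1 • A p.2 ^ p.1) :=
    (((commute_rieszMoment hr hsub 0).pow_left p.1).symm).smul_right _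
  have hannulus := rieszMoment_zero_eq_of_annulus hr hlt.le
    (annulus_subset_resolventSet hL hp.1 hp.2)
  simp only [Function.comp_apply, id_eq, compensatedDet, compensator]
  rw [compensator_mul (smul_transferInv_pow_mul hR hT (hr.trans hs₁) p.1 p.2) hcomm, hannulus]
  simp only [smul_mul_assoc, hP]
  rfl

/-- Holomorphy of `q` off `Λ`. -/
theorem analyticAt_qI0 (hL : 1 ≤ L) {E₀ : ℂ} (hE₀ : E₀ ∉ setLambda R V T) :
    AnalyticAt ℂ (qI0 R V T) E₀ := by
  obtain ⟨r₁, r₂, hr, hlt, hgap⟩ := exists_eventually_gap hL hE₀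
  rw [Complex.analyticAt_iff_eventually_differentiableAt]
  filter_upwards [hgap.eventually_nhds] with E hE
  obtain ⟨g₁, g₂⟩ := hE.self_of_nhds
  have hd : DifferentiableAt ℂ (fun y => rieszMoment (transferMatrix R V T y) r₁ 0) E :=
    differentiableAt_rieszMoment_zero hr (differentiable_transferMatrix E)
      (sphere_subset_resolventSet hL g₁ (hlt.trans g₂))
  have hb : DifferentiableAt ℂ
      (fun y => (rieszMoment (transferMatrix R V T y) r₁ 0).toBlocks₂₁) E :=
    differentiableAt_pi.2 fun i => differentiableAt_pi.2 fun j =>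
      differentiableAt_pi.1 (differentiableAt_pi.1 hd (Sum.inr i)) (Sum.inl j)
  have hdet : DifferentiableAt ℂ
      (fun y => (rieszMoment (transferMatrix R V T y) r₁ 0).toBlocks₂₁.det) E := by
    simp only [Matrix.det_apply]
    fun_prop
  refine hdet.congr_of_eventuallyEq ?_
  filter_upwards [hE] with y hy
  rw [qI0, rieszI0_eq_rieszMoment hL hr hy.1 (hlt.trans hy.2)]

theorem differentiableOn_det_compensator (hL : 1 ≤ L) {U : Set ℂ} {r₁ r₂ s : ℝ} (hr : 0 < r₁)
    (hlt : r₁ < r₂)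
    (hgap : ∀ E ∈ U, ‖eigZ R V T E L‖ < r₁ ∧ r₂ < ‖eigZ R V T E (L + 1)‖) (n : ℕ) :
    DifferentiableOn ℂ (fun E => (compensator R V T r₁ s n E).det) U := by
  have hP : DifferentiableOn ℂ (fun E => rieszMoment (transferMatrix R V T E) r₁ 0) U :=
    fun E hE => (differentiableAt_rieszMoment_zero hr (differentiable_transferMatrix E)
      (sphere_subset_resolventSet hL (hgap E hE).1
        (hlt.trans (hgap E hE).2))).differentiableWithinAt
  have hB : DifferentiableOn ℂ (transferInv R V T) U := differentiable_transferInv.differentiableOn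
  refine differentiableOn_det (DifferentiableOn.add hP (DifferentiableOn.mul ?_ ?_))
  · exact (hB.pow n).const_smul ((s : ℂ) ^ n)
  · exact (differentiableOn_const 1).sub hP

end BlockToeplitz

/-! ### Eigenvalue counts and zeros of `q` -/

namespace BlockToeplitz

open Filter Topology Metric Polynomial

variable {L : ℕ} {R V T : Matrix (Fin L) (Fin L) ℂ}

open Classical in
theorem countP_ball_roots_X_sub_C_pow (c : ℂ) (m : ℕ) {r : ℝ} (hr : 0 < r) :
    ((X - C c) ^ m : ℂ[X]).roots.countP (· ∈ ball c r) = m := by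
  rw [roots_pow, roots_X_sub_C, Multiset.countP_nsmul, Multiset.countP_eq_card.2]
  · simp
  · simp [hr]

/-- If `q` vanished to infinite order at a point off `Λ`, it would vanish on the whole component. -/
theorem analyticOrderAt_qI0_ne_top (hL : 1 ≤ L) {E : ℂ} (hE : E ∉ setLambda R V T)
    (hq : ∃ E' ∈ connectedComponentIn (setLambda R V T)ᶜ E, qI0 R V T E' ≠ 0) :
    analyticOrderAt (qI0 R V T) E ≠ ⊤ := by
  intro htop
  obtain ⟨E', hE', hne⟩ := hq
  have hana : AnalyticOnNhd ℂ (qI0 R V T) (connectedComponentIn (setLambda R V T)ᶜ E) :=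
    fun z hz => analyticAt_qI0 hL (connectedComponentIn_subset _ _ hz)
  exact hne (hana.eqOn_zero_of_preconnected_of_eventuallyEq_zero isPreconnected_connectedComponentIn
    (mem_connectedComponentIn hE) (analyticOrderAt_eq_top.1 htop) hE')

open Classical in
/-- Near an energy off `Λ` at which `q` has a zero of order `m`, Hurwitz's theorem applies to the
compensated determinants. -/
theorem exists_forall_eigCount_eq (hL : 1 ≤ L) (hR : IsUnit R) (hT : IsUnit T) {E : ℂ}
    (hE : E ∉ setLambda R V T) {m : ℕ} (hm : analyticOrderAt (qI0 R V T) E = m) :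
    ∃ ρ₀ : ℝ, 0 < ρ₀ ∧ ∀ ρ : ℝ, 0 < ρ → ρ < ρ₀ → ∃ N₀ : ℕ, ∀ N : ℕ, N₀ < N →
      eigCount (finiteHam R V T N) E ρ = m := by
  obtain ⟨r₁, r₂, hr, hlt, hgap⟩ := exists_eventually_gap hL hE
  obtain ⟨h, hh, hh0, hqh⟩ := (analyticAt_qI0 hL hE).analyticOrderAt_eq_natCast.1 hm
  obtain ⟨ρ₀, hρ₀, hball⟩ := Metric.eventually_nhds_iff_ball.1 (hgap.and (hqh.and
    ((hh.continuousAt.eventually_ne hh0).and hh.eventually_analyticAt)))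
  refine ⟨ρ₀, hρ₀, fun ρ hρ hρlt => ?_⟩
  have hgapU : ∀ x ∈ ball E ρ₀, ‖eigZ R V T x L‖ < r₁ ∧ r₂ < ‖eigZ R V T x (L + 1)‖ :=
    fun x hx => (hball x hx).1
  set s := (r₁ + r₂) / 2 with hs
  have hs₁ : r₁ < s := by rw [hs]; linarith
  have hs₂ : s < r₂ := by rw [hs]; linarith
  have hs₀ : 0 < s := hr.trans hs₁
  have hs' : (s : ℂ) ≠ 0 := Complex.ofReal_ne_zero.2 hs₀.ne'
  have hT' : (T⁻¹).det ≠ 0 := by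
    rw [Matrix.det_nonsing_inv, Ring.inverse_eq_inv']
    exact inv_ne_zero ((Matrix.isUnit_iff_isUnit_det T).1 hT).ne_zero
  have hev := eventually_countP_roots_eq (l := atTop) (c := E) (r := ρ) hρ (U := ball E ρ₀)
    isOpen_ball (closedBall_subset_ball hρlt)
    (f := fun N => compensatedDet R V T r₁ s (N + 1)) (p := fun N => (finiteHam R V T N).charpoly)
    (g := fun N x => (compensator R V T r₁ s (N + 1) x).det * (borderedHam R V T N x).det⁻¹ *
        ((((s : ℂ)⁻¹) ^ (N + 1)) ^ L * (T⁻¹).det *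
          (Matrix.fromBlocks 1 1 1 0 : Matrix (Fin L ⊕ Fin L) (Fin L ⊕ Fin L) ℂ).det))
    (f₀ := qI0 R V T) (g₀ := h) (p₀ := (X - C E) ^ m) ?_ ?_ ?_ ?_ ?_ ?_
  · obtain ⟨N₀, hN₀⟩ := eventually_atTop.1 hev
    refine ⟨N₀, fun N hN => ?_⟩
    rw [← countP_ball_roots_X_sub_C_pow E m hρ, ← hN₀ N hN.le, eigCount]
  · intro x hx
    have ht := tendsto_compensatedDet hR hT hL hr hs₁ hs₂ (E₀ := x)
      (by filter_upwards [isOpen_ball.mem_nhds hx] with y hy using hgapU y hy)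
    have hshift : Tendsto (fun p : ℕ × ℂ => (p.1 + 1, p.2)) (atTop ×ˢ 𝓝 x) (atTop ×ˢ 𝓝 x) :=
      ((tendsto_add_atTop_nat 1).comp tendsto_fst).prodMk tendsto_snd
    have hcomp := ht.comp hshift
    simp only [Function.comp_def] at hcomp
    exact hcomp
  · filter_upwards [eventually_gt_atTop 0] with N hN
    refine ⟨?_, fun x hx => ?_, fun x _ => compensatedDet_eq hT hN r₁ s x⟩
    · have hD := differentiableOn_det_compensator (s := s) hL hr hlt hgapU (N + 1)
      have hb : DifferentiableOn ℂ (fun x => (borderedHam R V T N x).det) (ball E ρ₀) :=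
        differentiableOn_det (differentiable_borderedHam N).differentiableOn
      exact (hD.mul (hb.inv fun x _ => det_borderedHam_ne_zero hT hN x)).mul_const _
    · refine mul_ne_zero (mul_ne_zero ?_ (inv_ne_zero (det_borderedHam_ne_zero hT hN x)))
        (mul_ne_zero (mul_ne_zero (pow_ne_zero _ (pow_ne_zero _ (inv_ne_zero hs'))) hT')
          det_fromBlocks_one_one_one_zero_ne_zero)
      exact det_compensator_ne_zero hR hT hL hr hlt hs₀ (hgapU x hx).1 (hgapU x hx).2 _
  · exact fun x hx => (hball x hx).2.2.2.differentiableAt.differentiableWithinAt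
  · exact fun x hx => (hball x hx).2.2.1
  · intro x hx
    rw [(hball x hx).2.1]
    simp
  · intro x hx
    simpa using pow_ne_zero m (sub_ne_zero.2 (ne_of_mem_sphere hx hρ.ne'))

end BlockToeplitz

theorem mainTheorem4 (L : ℕ) (hL : 1 ≤ L) (R V T : Matrix (Fin L) (Fin L) ℂ)
    (hR : IsUnit R) (hT : IsUnit T) (E : ℂ) (hE : E ∉ BlockToeplitz.setLambda R V T)
    (hq : ∃ E' ∈ connectedComponentIn (BlockToeplitz.setLambda R V T)ᶜ E,
      BlockToeplitz.qI0 R V T E' ≠ 0) :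
    AnalyticAt ℂ (BlockToeplitz.qI0 R V T) E ∧
      ∃ ρ₀ : ℝ, 0 < ρ₀ ∧ ∀ ρ : ℝ, 0 < ρ → ρ < ρ₀ → ∃ N₀ : ℕ, ∀ N : ℕ, N₀ < N →
        (BlockToeplitz.eigCount (BlockToeplitz.finiteHam R V T N) E ρ : ℕ∞) =
          analyticOrderAt (BlockToeplitz.qI0 R V T) E := by
  refine ⟨BlockToeplitz.analyticAt_qI0 hL hE, ?_⟩
  obtain ⟨m, hm⟩ := ENat.ne_top_iff_exists.1 (BlockToeplitz.analyticOrderAt_qI0_ne_top hL hE hq)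
  obtain ⟨ρ₀, hρ₀, hcount⟩ := BlockToeplitz.exists_forall_eigCount_eq hL hR hT hE hm.symm
  refine ⟨ρ₀, hρ₀, fun ρ hρ hlt => ?_⟩
  obtain ⟨N₀, hN₀⟩ := hcount ρ hρ hlt
  exact ⟨N₀, fun N hN => by rw [hN₀ N hN, hm]⟩
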